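/- Consider four buses $1,2,3,4$ with line susceptances $b_{ik}=b_{ki}\in\mathbb R$ ($1\le i<k\le 4$), so that $b\in\mathbb R^6$, and active power injections $P=(P_2,P_3,P_4)\in\mathbb R^3$. Bus $1$ is the slack bus, with $V_{d1}=1$, $V_{q1}=0$. The power flow equations of the lossless four-bus system of PV buses with unity voltage magnitudes are, in the unknowns $V_{di},V_{qi}$ ($i=2,3,4$), $$\sum_{k\ne i} b_{ik}\,(V_{dk}V_{qi}-V_{di}V_{qk})=P_i,\qquad V_{di}^2+V_{qi}^2=1,\qquad i=2,3,4.$$ Let $S(b,P)\subset\mathbb R^6$ be the set of real solutions. Fix any pair of buses $i\neq k$. Then the maximum number of real solutions is $16$ when $b_{ik}$ is at or near zero and $P$ is at or near zero, in the following sense. 1. (At zero.) For every $b\in\mathbb R^6$ with $b_{ik}=0$, the set $S(b,0)$ has at most $16$ isolated points; in particular, if $S(b,0)$ is finite, it has at most $16$ elements. 2. (Near zero.) For every $b\in\mathbb R^6$ with $b_{ik}=0$ for which $S(b,0)$ is finite, there is a neighbourhood of $(b,0)$ in $\mathbb R^6\times\mathbb R^3$ such that $S(b',P')$ has at most $16$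 elements for all $(b',P')$ in it. 3. (Genericity.) The finiteness assumed in 2 is generic: there is a polynomial $p$ in the susceptances, not identically zero on $\{b_{ik}=0\}$, such that $S(b,0)$ is finite whenever $b_{ik}=0$ and $p(b)\ne0$. 4. (Sharpness.) There is $b\in\mathbb R^6$ with $b_{ik}=0$ such that $S(b',P')$ has exactly $16$ elements for all $(b',P')$ in some neighbourhood of $(b,0)$. -/

import Mathlib

open Topology

/-- The six lines of a four-bus network: unordered pairs of distinct buses.
Bus `0` is the slack bus, the buses `1, 2, 3` are the PV buses. -/
abbrev Line : Type := {e : Sym2 (Fin 4) // ¬ e.IsDiag}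

/-- The susceptance `b_{ik} = b_{ki}` of the line joining `i` and `k`. The value at `i = k`
is never used, since the corresponding term of the power flow equations vanishes. -/
def susceptance (b : Line → ℝ) (i k : Fin 4) : ℝ :=
  if h : i = k then 0 else b ⟨s(i, k), by simpa using h⟩

/-- The variables `(V_d, V_q)` at the three PV buses; entry `i : Fin 3` belongs to bus `i.succ`. -/
abbrev VoltageState : Type := (Fin 3 → ℝ) × (Fin 3 → ℝ)

/-- Real parts of the voltage phasors at all four buses (`V_d = 1` at the slack bus). -/
def busVd (x : VoltageState) : Fin 4 → ℝ := Fin.cons 1 x.1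

/-- Imaginary parts of the voltage phasors at all four buses (`V_q = 0` at the slack bus). -/
def busVq (x : VoltageState) : Fin 4 → ℝ := Fin.cons 0 x.2

/-- The set of real solutions of the power flow equations of the lossless four-bus system of
PV buses with unit voltage magnitudes, susceptances `b` and active power injections `P`. -/
def realSolutions (b : Line → ℝ) (P : Fin 3 → ℝ) : Set VoltageState :=
  {x | ∀ i : Fin 3,
    (∑ k : Fin 4, susceptance b i.succ k *
      (busVd x k * busVq x i.succ - busVd x i.succ * busVq x k) = P i) ∧
    busVd x i.succ ^ 2 + busVq x i.succ ^ 2 = 1}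

/-- The points of `S` that are isolated in `S`. -/
def isolatedPoints {X : Type*} [TopologicalSpace X] (S : Set X) : Set X :=
  {x | x ∈ S ∧ ∃ U : Set X, IsOpen U ∧ U ∩ S = {x}}

/-! Relabelling the buses moves the missing line to `{2, 3}`, so that buses 2 and 3 are joined only
to buses 0 and 1. Let `φ` be the phase angle of bus 1. At zero injection the balance at bus 2 says
that its voltage is parallel to the phasor `A = a + d e^{iφ}`; if `A ≠ 0` it is `s A/|A|` with `s =
±1`. Likewise bus 3 has voltage `s' B/|B|` with `B = f + g e^{iφ}`. The balance at bus 1 then reads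
`sin φ (c + s ad/|A| + s' fg/|B|) = 0` (`branchBalance`). The product over the four sign pairs is,
up to a nonvanishing factor, `sin⁴ φ · Q(cos φ)` with `Q = signProduct` of degree at most four
(`prod_branchBalance`). On the circle `sin⁴ φ` has 8 zeros and `Q(cos φ)`, if `Q ≠ 0`, at most 8,
with multiplicity: 16 in all (`sum_solutionWeight_le`).

Counting with multiplicity is what controls perturbations. Where `A, B ≠ 0`, the implicit function
theorem eliminates buses 2 and 3, and Rolle's theorem bounds the number of nearby solutions of
nearby systems by the order of vanishing on the branch (`local_encard_le_order`). Where exactly one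
of `A, B` vanishes, all voltages are real and the solution is nondegenerate; it counts once, and
there are at most four over the same `φ`, which the factor `sin⁴ φ` pays for. Compactness of the
torus of unit voltages adds up the local bounds.

The remaining cases give continua. A bus with `a = d = 0` or `f = g = 0` rotates freely; points with
`A = B = 0` lie on a curve of solutions; and if `Q = 0`, then every solution with `sin φ ≠ 0` lies
on a curve, which leaves at most 8 isolated points, with real voltages. Finiteness of the solution
set excludes all of these. For sharpness, an explicit network has 16 nondegenerate solutions, which
persist under perturbation. -/

open Set Filter
open scoped ContDiff

/-! ### Zeros of analytic families in one variable -/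

/-- **Rolle's theorem**, counting form. -/
theorem encard_zeros_le_of_deriv {f f' : ℝ → ℝ} {I : Set ℝ} (hI : I.OrdConnected)
    (hf : ∀ x ∈ I, HasDerivAt f (f' x) x) {n : ℕ}
    (h : {x | x ∈ I ∧ f' x = 0}.encard ≤ n) :
    {x | x ∈ I ∧ f x = 0}.encard ≤ (n + 1 : ℕ) := by
  by_contra! hlt
  have hle : ((n + 2 : ℕ) : ℕ∞) ≤ {x | x ∈ I ∧ f x = 0}.encard := by
    have := Order.add_one_le_of_lt hlt
    push_cast at this ⊢
    rwa [add_assoc, one_add_one_eq_two] at this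
  obtain ⟨t, hts, htc⟩ := Set.exists_subset_encard_eq hle
  have htf : t.Finite := Set.finite_of_encard_eq_coe htc
  have hcard : htf.toFinset.card = n + 2 := by
    have := htf.encard_eq_coe_toFinset_card
    rw [htc] at this
    exact_mod_cast this.symm
  set s := htf.toFinset.orderEmbOfFin hcard
  have hs : ∀ i, s i ∈ I ∧ f (s i) = 0 := fun i =>
    hts (htf.mem_toFinset.1 (Finset.orderEmbOfFin_mem _ hcard i))
  -- The `n + 2` ordered zeros bound `n + 1` disjoint gaps, each containing a zero of the
  -- derivative.
  have key : ∀ i : Fin (n + 1), ∃ y ∈ Ioo (s i.castSucc) (s i.succ), f' y = 0 := by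
    intro i
    have hlt' : s i.castSucc < s i.succ := s.strictMono i.castSucc_lt_succ
    have hsub : Icc (s i.castSucc) (s i.succ) ⊆ I := hI.out (hs _).1 (hs _).1
    refine exists_hasDerivAt_eq_zero hlt'
      (fun y hy => (hf y (hsub hy)).continuousAt.continuousWithinAt) ?_
      (fun y hy => hf y (hsub (Ioo_subset_Icc_self hy)))
    rw [(hs _).2, (hs _).2]
  choose y hy hy0 using key
  have hmono : StrictMono y := by
    refine Fin.strictMono_iff_lt_succ.2 fun i => ?_
    have h1 := (hy i.castSucc).2
    have h2 := (hy i.succ).1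
    rw [Fin.succ_castSucc] at h1
    exact h1.trans h2
  have hrange : range y ⊆ {x | x ∈ I ∧ f' x = 0} := by
    rintro _ ⟨i, rfl⟩
    exact ⟨hI.out (hs _).1 (hs _).1 (Ioo_subset_Icc_self (hy i)), hy0 i⟩
  have h1 : (range y).encard = (n + 1 : ℕ) := by
    rw [← image_univ, hmono.injective.encard_image]
    simp
  have h2 := (encard_le_encard hrange).trans h
  rw [h1] at h2
  have : n + 1 ≤ n := by exact_mod_cast h2
  omega

section Parametric

variable {E : Type*} [NormedAddCommGroup E] [NormedSpace ℝ E]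

/-- The partial derivative in the last, real, variable. -/
theorem ContDiffAt.exists_partial_deriv {g : E × ℝ → ℝ} {u : E × ℝ}
    (hg : ContDiffAt ℝ ω g u) : ∃ g' : E × ℝ → ℝ, ContDiffAt ℝ ω g' u ∧
      ∀ᶠ v in 𝓝 u, HasDerivAt (fun t => g (v.1, t)) (g' v) v.2 := by
  refine ⟨fun v => fderiv ℝ g v (0, 1), ?_, ?_⟩
  · have : ContDiffAt ℝ ω (fderiv ℝ g) u := hg.fderiv_right (by simp)
    exact this.clm_apply contDiffAt_const
  · have h1 : ∀ᶠ v in 𝓝 u, ContDiffAt ℝ ω g v := hg.eventually (by simp)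
    filter_upwards [h1] with v hv
    have h2 : HasFDerivAt g (fderiv ℝ g v) (v.1, v.2) :=
      (hv.differentiableAt (by simp)).hasFDerivAt
    have h3 : HasDerivAt (fun t : ℝ => (v.1, t)) ((0 : E), (1 : ℝ)) v.2 :=
      (hasDerivAt_const _ _).prodMk (hasDerivAt_id _)
    exact h2.comp_hasDerivAt v.2 h3

/-- A family of analytic functions of one variable has, close to a zero of finite order of one
member, at most as many zeros as that order. -/
theorem eventually_encard_zeros_le {g : E × ℝ → ℝ} {q : E} {t : ℝ}
    (hg : ContDiffAt ℝ ω g (q, t)) :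
    ∃ δ > 0, ∀ᶠ q' in 𝓝 q, {t' | t' ∈ Ioo (t - δ) (t + δ) ∧ g (q', t') = 0}.encard ≤
      analyticOrderAt (fun t' => g (q, t')) t := by
  have han : ∀ {g : E × ℝ → ℝ}, ContDiffAt ℝ ω g (q, t) →
      AnalyticAt ℝ (fun t' => g (q, t')) t := by
    intro g hg
    have : ContDiffAt ℝ ω (fun t' => g (q, t')) t :=
      ContDiffAt.comp t hg (contDiffAt_const.prodMk contDiffAt_id)
    exact this.analyticAt
  rcases eq_or_ne (analyticOrderAt (fun t' => g (q, t')) t) ⊤ with htop | htop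
  -- For a zero of infinite order the bound is `⊤` and says nothing.
  · exact ⟨1, one_pos, by simp [htop]⟩
  obtain ⟨n, hn⟩ := ENat.ne_top_iff_exists.1 htop
  rw [← hn]
  clear htop
  induction n generalizing g with
  | zero =>
    have h0 : g (q, t) ≠ 0 := by
      have := (han hg).analyticOrderAt_eq_zero.1 hn.symm
      exact this
    have h1 : ∀ᶠ v in 𝓝 (q, t), g v ≠ 0 := hg.continuousAt.eventually_ne h0
    rw [nhds_prod_eq] at h1
    obtain ⟨pa, hpa, pb, hpb, h⟩ := eventually_prod_iff.1 h1
    obtain ⟨δ, hδ, hball⟩ := Metric.eventually_nhds_iff_ball.1 hpb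
    refine ⟨δ, hδ, ?_⟩
    filter_upwards [hpa] with q' hq'
    rw [Nat.cast_zero, nonpos_iff_eq_zero, encard_eq_zero, eq_empty_iff_forall_notMem]
    rintro t' ⟨ht', h0'⟩
    exact h hq' (hball t' (by rwa [Real.ball_eq_Ioo])) h0'
  | succ n ih =>
    -- Differentiation lowers the order of the zero by one, and Rolle's theorem costs one zero in
    -- the count.
    obtain ⟨g', hg', hder⟩ := hg.exists_partial_deriv
    have hd0 : deriv (fun t' => g (q, t')) =ᶠ[𝓝 t] fun t' => g' (q, t') := by
      have : Tendsto (fun t' : ℝ => (q, t')) (𝓝 t) (𝓝 (q, t)) :=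
        (by fun_prop : Continuous fun t' : ℝ => (q, t')).tendsto t
      filter_upwards [this.eventually hder] with t' ht'
      exact ht'.deriv
    have hz : g (q, t) = 0 := by
      have : analyticOrderAt (fun t' => g (q, t')) t ≠ 0 := by rw [← hn]; simp
      exact ((han hg).analyticOrderAt_ne_zero).1 this
    have hord := (han hg).analyticOrderAt_deriv_add_one
    simp only [hz, sub_zero] at hord
    rw [analyticOrderAt_congr hd0, ← hn] at hord
    have hord' : ((n : ℕ) : ℕ∞) = analyticOrderAt (fun t' => g' (q, t')) t := by
      push_cast at hord
      exact (ENat.add_left_injective_of_ne_top ENat.one_ne_top hord).symm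
    obtain ⟨δ, hδ, hev⟩ := ih hg' hord'
    rw [nhds_prod_eq] at hder
    obtain ⟨pa, hpa, pb, hpb, h⟩ := eventually_prod_iff.1 hder
    obtain ⟨δ', hδ', hball⟩ := Metric.eventually_nhds_iff_ball.1 hpb
    refine ⟨min δ δ', lt_min hδ hδ', ?_⟩
    filter_upwards [hpa, hev] with q' hq' hcount
    refine encard_zeros_le_of_deriv (f' := fun t' => g' (q', t')) ordConnected_Ioo ?_ ?_
    · intro t' ht'
      refine h hq' (hball t' ?_)
      rw [Real.ball_eq_Ioo]
      exact ⟨by linarith [ht'.1, min_le_right δ δ'], by linarith [ht'.2, min_le_right δ δ']⟩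
    · refine (encard_le_encard ?_).trans hcount
      rintro t' ⟨ht', h0⟩
      exact ⟨⟨by linarith [ht'.1, min_le_left δ δ'], by linarith [ht'.2, min_le_left δ δ']⟩, h0⟩

end Parametric

/-! ### Elimination of variables by the implicit function theorem -/

section Implicit

variable {E Y : Type*} [NormedAddCommGroup E] [NormedSpace ℝ E]
  [NormedAddCommGroup Y] [NormedSpace ℝ Y]

theorem fderiv_comp_inr_isInvertible {H : E × Y → Y} {q : E} {y : Y}
    (hH : ContDiffAt ℝ ω H (q, y)) {A : Y →L[ℝ] Y} (hA : A.IsInvertible)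
    (hder : HasFDerivAt (fun y' => H (q, y')) A y) :
    (fderiv ℝ H (q, y) ∘L .inr ℝ E Y).IsInvertible := by
  have h1 : HasFDerivAt H (fderiv ℝ H (q, y)) (q, y) :=
    (hH.differentiableAt (by simp)).hasFDerivAt
  have h2 : HasFDerivAt (fun y' : Y => (q, y')) (ContinuousLinearMap.inr ℝ E Y) y :=
    hasFDerivAt_prodMk_right q y
  have h3 := (h1.comp y h2).unique hder
  rwa [h3]

variable [CompleteSpace E] [CompleteSpace Y]

/-- Implicit function theorem for an analytic system with invertible partial derivative. -/
theorem exists_implicit {H : E × Y → Y} {q : E} {y : Y}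
    (hH : ContDiffAt ℝ ω H (q, y)) (h0 : H (q, y) = 0) {A : Y →L[ℝ] Y} (hA : A.IsInvertible)
    (hder : HasFDerivAt (fun y' => H (q, y')) A y) :
    ∃ ψ : E → Y, ContDiffAt ℝ ω ψ q ∧ ψ q = y ∧ (∀ᶠ q' in 𝓝 q, H (q', ψ q') = 0) ∧
      ∀ᶠ v in 𝓝 (q, y), H v = 0 ↔ ψ v.1 = v.2 := by
  have hinv := fderiv_comp_inr_isInvertible hH hA hder
  refine ⟨hH.implicitFunction (by simp) hinv, hH.contDiffAt_implicitFunction (by simp) hinv,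
    hH.implicitFunction_apply_self (by simp) hinv, ?_, ?_⟩
  · have := hH.eventually_apply_implicitFunction (by simp) hinv
    simpa only [h0] using this
  · have := hH.eventually_apply_eq_iff_implicitFunction (by simp) hinv
    simpa only [h0] using this

/-- A nondegenerate zero persists. -/
theorem eventually_exists_zero {H : E × Y → Y} {q : E} {y : Y}
    (hH : ContDiffAt ℝ ω H (q, y)) (h0 : H (q, y) = 0) {A : Y →L[ℝ] Y} (hA : A.IsInvertible)
    (hder : HasFDerivAt (fun y' => H (q, y')) A y) {U : Set Y} (hU : U ∈ 𝓝 y) :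
    ∀ᶠ q' in 𝓝 q, ∃ y' ∈ U, H (q', y') = 0 := by
  obtain ⟨ψ, hψ, hψ0, hz, -⟩ := exists_implicit hH h0 hA hder
  have : ∀ᶠ q' in 𝓝 q, ψ q' ∈ U := hψ.continuousAt.eventually_mem (by rwa [hψ0])
  filter_upwards [hz, this] with q' h1 h2
  exact ⟨_, h2, h1⟩

/-- A nondegenerate zero is locally the only one. -/
theorem eventually_encard_zeros_le_one {H : E × Y → Y} {q : E} {y : Y}
    (hH : ContDiffAt ℝ ω H (q, y)) (h0 : H (q, y) = 0) {A : Y →L[ℝ] Y} (hA : A.IsInvertible)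
    (hder : HasFDerivAt (fun y' => H (q, y')) A y) :
    ∃ U ∈ 𝓝 y, ∀ᶠ q' in 𝓝 q, {y' | y' ∈ U ∧ H (q', y') = 0}.encard ≤ 1 := by
  obtain ⟨ψ, -, -, -, hu⟩ := exists_implicit hH h0 hA hder
  rw [nhds_prod_eq] at hu
  obtain ⟨pa, hpa, pb, hpb, h⟩ := eventually_prod_iff.1 hu
  refine ⟨{y' | pb y'}, hpb, ?_⟩
  filter_upwards [hpa] with q' hq'
  rw [encard_le_one_iff]
  rintro y₁ y₂ ⟨h1, h1'⟩ ⟨h2, h2'⟩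
  exact ((h hq' h1).1 h1').symm.trans ((h hq' h2).1 h2')

/-- If all variables but one can be eliminated, the number of nearby solutions of a perturbed
system is at most the order of vanishing of the eliminated equation. -/
theorem eventually_encard_zeros_le_order {H : (E × ℝ) × Y → Y} {F : (E × ℝ) × Y → ℝ}
    {q : E} {t : ℝ} {γ : ℝ → Y} (hH : ContDiffAt ℝ ω H ((q, t), γ t))
    (hF : ContDiffAt ℝ ω F ((q, t), γ t)) (hγ : ContinuousAt γ t)
    (h0 : ∀ᶠ t' in 𝓝 t, H ((q, t'), γ t') = 0)
    {A : Y →L[ℝ] Y} (hA : A.IsInvertible)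
    (hder : HasFDerivAt (fun y' => H ((q, t), y')) A (γ t)) :
    ∃ U ∈ 𝓝 (t, γ t), ∀ᶠ q' in 𝓝 q,
      {p : ℝ × Y | p ∈ U ∧ H ((q', p.1), p.2) = 0 ∧ F ((q', p.1), p.2) = 0}.encard ≤
        analyticOrderAt (fun t' => F ((q, t'), γ t')) t := by
  obtain ⟨ψ, hψ, hψ0, hz, hu⟩ := exists_implicit hH h0.self_of_nhds hA hder
  have hg : ContDiffAt ℝ ω (fun v => F (v, ψ v)) (q, t) := by
    refine ContDiffAt.comp (q, t) (g := F) ?_ (contDiffAt_id.prodMk hψ)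
    simpa [hψ0] using hF
  obtain ⟨δ, hδ, hcount⟩ := eventually_encard_zeros_le hg
  -- By local uniqueness the continuous curve of zeros `γ` is the implicit function at the parameter
  -- `q`; so only continuity of `γ` is needed.
  have hψγ : (fun t' => F ((q, t'), ψ (q, t'))) =ᶠ[𝓝 t] fun t' => F ((q, t'), γ t') := by
    have htend : Tendsto (fun t' : ℝ => ((q, t'), γ t')) (𝓝 t) (𝓝 ((q, t), γ t)) :=
      (ContinuousAt.prodMk (by fun_prop) hγ : ContinuousAt _ t)
    filter_upwards [htend.eventually hu, h0] with t' h1 h2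
    have h3 : ψ (q, t') = γ t' := h1.1 h2
    rw [h3]
  rw [analyticOrderAt_congr hψγ] at hcount
  rw [nhds_prod_eq] at hu
  obtain ⟨pa, hpa, pb, hpb, h⟩ := eventually_prod_iff.1 hu
  rw [nhds_prod_eq] at hpa
  obtain ⟨pc, hpc, pd, hpd, h'⟩ := eventually_prod_iff.1 hpa
  refine ⟨(Ioo (t - δ) (t + δ) ∩ {t' | pd t'}) ×ˢ {y | pb y},
    prod_mem_nhds (inter_mem (Ioo_mem_nhds (by linarith) (by linarith)) hpd) hpb, ?_⟩
  filter_upwards [hcount, hpc] with q' hq hq'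
  refine le_trans ?_ hq
  refine encard_le_encard_of_injOn (f := Prod.fst) ?_ ?_
  · rintro ⟨t', y'⟩ ⟨⟨⟨h1, h2⟩, h3⟩, h4, h5⟩
    have h6 : ψ (q', t') = y' := (h (h' hq' h2) h3).1 h4
    refine ⟨h1, ?_⟩
    rw [h6]
    exact h5
  · rintro ⟨t', y'⟩ ⟨⟨⟨-, h2⟩, h3⟩, h4, -⟩ ⟨t'', y''⟩ ⟨⟨⟨-, h2'⟩, h3'⟩, h4', -⟩ heq
    obtain rfl : t' = t'' := heq
    have h6 : ψ (q', t') = y' := (h (h' hq' h2) h3).1 h4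
    have h7 : ψ (q', t') = y'' := (h (h' hq' h2') h3').1 h4'
    rw [← h6, ← h7]

end Implicit

theorem isInvertible_toLin'_of_det_ne_zero {n : ℕ} (M : Matrix (Fin n) (Fin n) ℝ)
    (hM : M.det ≠ 0) : (Matrix.toLin' M).toContinuousLinearMap.IsInvertible := by
  have hu : IsUnit (LinearMap.det (Matrix.toLin' M)) := by
    rw [LinearMap.det_toLin']
    exact hM.isUnit
  refine ⟨(LinearEquiv.ofIsUnitDet (f := Matrix.toLin' M) (v := Pi.basisFun ℝ (Fin n))
    (v' := Pi.basisFun ℝ (Fin n)) ?_).toContinuousLinearEquiv, ?_⟩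
  · rw [LinearMap.toMatrix_eq_toMatrix', LinearMap.toMatrix'_toLin']
    exact hM.isUnit
  · ext v i
    rfl

/-! ### From local to global counts -/

/-- If a closed family of subsets of a compact set has a finite member, and close to each point
`x` of it the other members have at most `n x` points, then close to it the members have at most
`∑ n x` points. -/
theorem eventually_encard_le_sum {Q X : Type*} [TopologicalSpace Q] [TopologicalSpace X]
    {K : Set X} (hK : IsCompact K) {S : Q → Set X} (hS : ∀ q, S q ⊆ K)
    (hclosed : IsClosed {p : Q × X | p.2 ∈ S p.1}) {q₀ : Q} (T : Finset X)
    (hT : S q₀ = T) (n : X → ℕ∞)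
    (hn : ∀ x ∈ T, ∃ U ∈ 𝓝 x, ∀ᶠ q in 𝓝 q₀, (U ∩ S q).encard ≤ n x) :
    ∀ᶠ q in 𝓝 q₀, (S q).encard ≤ ∑ x ∈ T, n x := by
  classical
  -- A point outside `T` gets the bound 0: the graph is closed, so near that point there are no
  -- solutions for parameters close to `q₀`.
  have hn' : ∀ x : X, ∃ U ∈ 𝓝 x, ∀ᶠ q in 𝓝 q₀, (U ∩ S q).encard ≤ if x ∈ T then n x else 0 := by
    intro x
    by_cases hx : x ∈ T
    · simpa [hx] using hn x hx
    · have hx' : (q₀, x) ∈ {p : Q × X | p.2 ∈ S p.1}ᶜ := by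
        simp [hT, hx]
      have := hclosed.isOpen_compl.mem_nhds hx'
      rw [nhds_prod_eq] at this
      obtain ⟨V, hV, U, hU, hVU⟩ := Filter.mem_prod_iff.1 this
      refine ⟨U, hU, ?_⟩
      filter_upwards [hV] with q hq
      simp only [hx, if_false, nonpos_iff_eq_zero, encard_eq_zero]
      refine eq_empty_iff_forall_notMem.2 ?_
      rintro y ⟨hy, hy'⟩
      exact hVU (mk_mem_prod hq hy) hy'
  choose U hU hUn using hn'
  obtain ⟨t, htK, htc⟩ := hK.elim_nhds_subcover U fun x _ => hU x
  have hev : ∀ᶠ q in 𝓝 q₀, ∀ x ∈ t, (U x ∩ S q).encard ≤ if x ∈ T then n x else 0 :=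
    (Finset.eventually_all t).2 fun x _ => hUn x
  filter_upwards [hev] with q hq
  have hsub : S q ⊆ ⋃ x ∈ t, (U x ∩ S q) := by
    intro y hy
    obtain ⟨x, hx, hxy⟩ := mem_iUnion₂.1 (htc (hS q hy))
    exact mem_iUnion₂.2 ⟨x, hx, hxy, hy⟩
  have hbu : ∀ (t : Finset X), (⋃ x ∈ t, (U x ∩ S q)).encard ≤ ∑ x ∈ t, (U x ∩ S q).encard := by
    intro t
    induction t using Finset.induction_on with
    | empty => simp
    | insert a s ha ih =>
      rw [Finset.sum_insert ha, Finset.set_biUnion_insert]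
      exact (encard_union_le _ _).trans (by gcongr)
  calc (S q).encard ≤ ∑ x ∈ t, (U x ∩ S q).encard := (encard_le_encard hsub).trans (hbu t)
    _ ≤ ∑ x ∈ t, if x ∈ T then n x else 0 := Finset.sum_le_sum hq
    _ = ∑ x ∈ t with x ∈ T, n x := (Finset.sum_filter _ _).symm
    _ ≤ ∑ x ∈ T, n x := Finset.sum_le_sum_of_subset fun x hx => (Finset.mem_filter.1 hx).2

/-- If each point of a finite set `T` lies in the closure of the family `S` as the parameter tends
to `q₀`, then eventually the members have at least as many points as `T`. -/
theorem eventually_card_le_encard {Q X : Type*} [TopologicalSpace Q] [TopologicalSpace X]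
    [T2Space X] {S : Q → Set X} {q₀ : Q} (T : Finset X)
    (h : ∀ x ∈ T, ∀ U ∈ 𝓝 x, ∀ᶠ q in 𝓝 q₀, (U ∩ S q).Nonempty) :
    ∀ᶠ q in 𝓝 q₀, (T.card : ℕ∞) ≤ (S q).encard := by
  obtain ⟨U, hU, hdisj⟩ := T.finite_toSet.t2_separation
  have hev : ∀ᶠ q in 𝓝 q₀, ∀ x ∈ T, (U x ∩ S q).Nonempty :=
    (Finset.eventually_all T).2 fun x hx => h x hx _ ((hU x).2.mem_nhds (hU x).1)
  filter_upwards [hev] with q hq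
  choose! y hy using hq
  rw [← encard_coe_eq_coe_finsetCard]
  refine encard_le_encard_of_injOn (f := y) (fun x hx => (hy x hx).2) ?_
  intro x hx x' hx' hxx
  by_contra hne
  exact (Set.disjoint_left.1 (hdisj hx hx' hne)) (hy x hx).1 (hxx ▸ (hy x' hx').1)

/-! ### The power flow equations in phase angles -/

/-- Power mismatches at the PV buses, as functions of the phase angles. -/
noncomputable def mismatch (q : (Line → ℝ) × (Fin 3 → ℝ)) (θ : Fin 3 → ℝ) (i : Fin 3) : ℝ :=
  ∑ k : Fin 4, susceptance q.1 i.succ k *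
    Real.sin ((Fin.cons 0 θ : Fin 4 → ℝ) i.succ - (Fin.cons 0 θ : Fin 4 → ℝ) k) - q.2 i

/-- The state with given phase angles. -/
noncomputable def angleState (θ : Fin 3 → ℝ) : VoltageState :=
  (fun i => Real.cos (θ i), fun i => Real.sin (θ i))

theorem susceptance_comm (b : Line → ℝ) (i k : Fin 4) : susceptance b i k = susceptance b k i := by
  unfold susceptance
  by_cases h : i = k
  · simp [h]
  · have h' : ¬ k = i := fun h' => h h'.symm
    simp only [h, h', dite_false]
    congr 2
    exact Sym2.eq_swap

theorem contDiff_susceptance (i k : Fin 4) :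
    ContDiff ℝ ω (fun b : Line → ℝ => susceptance b i k) := by
  unfold susceptance
  split_ifs
  · exact contDiff_const
  · exact contDiff_apply ℝ ℝ _

theorem continuous_susceptance (i k : Fin 4) :
    Continuous (fun b : Line → ℝ => susceptance b i k) :=
  (contDiff_susceptance i k).continuous

theorem contDiff_mismatch :
    ContDiff ℝ ω (fun p : ((Line → ℝ) × (Fin 3 → ℝ)) × (Fin 3 → ℝ) => mismatch p.1 p.2) := by
  have hcons : ∀ k : Fin 4, ContDiff ℝ ω
      (fun p : ((Line → ℝ) × (Fin 3 → ℝ)) × (Fin 3 → ℝ) => (Fin.cons 0 p.2 : Fin 4 → ℝ) k) := by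
    intro k
    refine Fin.cases ?_ (fun j => ?_) k
    · simpa using contDiff_const
    · simp only [Fin.cons_succ]
      fun_prop
  refine contDiff_pi.2 fun i => ?_
  unfold mismatch
  refine ContDiff.sub (ContDiff.sum fun k _ => ContDiff.mul ?_ ?_) (by fun_prop)
  · exact (contDiff_susceptance i.succ k).comp (contDiff_fst.comp contDiff_fst)
  · exact Real.contDiff_sin.comp ((hcons _).sub (hcons _))

theorem mismatch_zero (q : (Line → ℝ) × (Fin 3 → ℝ)) (θ : Fin 3 → ℝ) :
    mismatch q θ 0 = susceptance q.1 0 1 * Real.sin (θ 0) +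
      susceptance q.1 1 2 * Real.sin (θ 0 - θ 1) +
      susceptance q.1 1 3 * Real.sin (θ 0 - θ 2) - q.2 0 := by
  have h1 : (Fin.cons 0 θ : Fin 4 → ℝ) 1 = θ 0 := rfl
  have h2 : (Fin.cons 0 θ : Fin 4 → ℝ) 2 = θ 1 := rfl
  have h3 : (Fin.cons 0 θ : Fin 4 → ℝ) 3 = θ 2 := rfl
  simp [mismatch, Fin.sum_univ_four, h1, h2, h3, susceptance_comm q.1 1 0]

theorem mismatch_one (q : (Line → ℝ) × (Fin 3 → ℝ)) (θ : Fin 3 → ℝ) :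
    mismatch q θ 1 = susceptance q.1 0 2 * Real.sin (θ 1) +
      susceptance q.1 1 2 * Real.sin (θ 1 - θ 0) +
      susceptance q.1 2 3 * Real.sin (θ 1 - θ 2) - q.2 1 := by
  have h0 : Fin.succ (1 : Fin 3) = 2 := rfl
  have h1 : (Fin.cons 0 θ : Fin 4 → ℝ) 1 = θ 0 := rfl
  have h2 : (Fin.cons 0 θ : Fin 4 → ℝ) 2 = θ 1 := rfl
  have h3 : (Fin.cons 0 θ : Fin 4 → ℝ) 3 = θ 2 := rfl
  simp [mismatch, Fin.sum_univ_four, h0, h1, h2, h3, susceptance_comm q.1 2 0,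
    susceptance_comm q.1 2 1]

theorem mismatch_two (q : (Line → ℝ) × (Fin 3 → ℝ)) (θ : Fin 3 → ℝ) :
    mismatch q θ 2 = susceptance q.1 0 3 * Real.sin (θ 2) +
      susceptance q.1 1 3 * Real.sin (θ 2 - θ 0) +
      susceptance q.1 2 3 * Real.sin (θ 2 - θ 1) - q.2 2 := by
  have h0 : Fin.succ (2 : Fin 3) = 3 := rfl
  have h1 : (Fin.cons 0 θ : Fin 4 → ℝ) 1 = θ 0 := rfl
  have h2 : (Fin.cons 0 θ : Fin 4 → ℝ) 2 = θ 1 := rfl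
  have h3 : (Fin.cons 0 θ : Fin 4 → ℝ) 3 = θ 2 := rfl
  simp [mismatch, Fin.sum_univ_four, h0, h1, h2, h3, susceptance_comm q.1 3 0,
    susceptance_comm q.1 3 1, susceptance_comm q.1 3 2]

/-- The unit conditions are automatic, and `V_dk V_qi - V_di V_qk` is the sine of the difference of
the phase angles. -/
theorem angleState_mem_iff (q : (Line → ℝ) × (Fin 3 → ℝ)) (θ : Fin 3 → ℝ) :
    angleState θ ∈ realSolutions q.1 q.2 ↔ mismatch q θ = 0 := by
  have hd : ∀ k, busVd (angleState θ) k = Real.cos ((Fin.cons 0 θ : Fin 4 → ℝ) k) := by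
    intro k
    refine Fin.cases ?_ (fun j => ?_) k <;> simp [busVd, angleState]
  have hq : ∀ k, busVq (angleState θ) k = Real.sin ((Fin.cons 0 θ : Fin 4 → ℝ) k) := by
    intro k
    refine Fin.cases ?_ (fun j => ?_) k <;> simp [busVq, angleState]
  simp only [realSolutions, mem_ofPred_eq, hd, hq, Real.cos_sq_add_sin_sq, and_true, funext_iff,
    mismatch, Pi.zero_apply, sub_eq_zero, Real.sin_sub]
  refine forall_congr' fun i => ?_
  rw [Finset.sum_congr rfl]
  intro k _
  ring

theorem continuous_angleState : Continuous angleState := by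
  unfold angleState
  fun_prop

theorem unit_of_mem_realSolutions {b : Line → ℝ} {P : Fin 3 → ℝ} {x : VoltageState}
    (hx : x ∈ realSolutions b P) (i : Fin 3) : x.1 i ^ 2 + x.2 i ^ 2 = 1 := by
  simpa [busVd, busVq] using (hx i).2

theorem exists_cos_sin {u v : ℝ} (h : u ^ 2 + v ^ 2 = 1) :
    ∃ t : ℝ, Real.cos t = u ∧ Real.sin t = v := by
  have hn : ‖(⟨u, v⟩ : ℂ)‖ = 1 := by
    rw [← sq_eq_sq₀ (norm_nonneg _) zero_le_one, Complex.sq_norm, Complex.normSq_apply]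
    simp only
    nlinarith
  have h0 : (⟨u, v⟩ : ℂ) ≠ 0 := by
    intro h0
    simp [h0] at hn
  refine ⟨Complex.arg ⟨u, v⟩, ?_, ?_⟩
  · simp [Complex.cos_arg h0, hn]
  · simp [Complex.sin_arg, hn]

/-- Local continuous choice of an angle. -/
theorem exists_angle_lift (t : ℝ) : ∃ Θ : ℝ × ℝ → ℝ,
    ContinuousAt Θ (Real.cos t, Real.sin t) ∧ Θ (Real.cos t, Real.sin t) = t ∧
      ∀ p : ℝ × ℝ, p.1 ^ 2 + p.2 ^ 2 = 1 → Real.cos (Θ p) = p.1 ∧ Real.sin (Θ p) = p.2 := by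
  -- `Z p` is `p` rotated by `-t`; the base point goes to 1, away from the branch cut of
  -- `Complex.arg`.
  set Z : ℝ × ℝ → ℂ := fun p => ⟨p.1 * Real.cos t + p.2 * Real.sin t,
    p.2 * Real.cos t - p.1 * Real.sin t⟩ with hZ
  have hZc : Continuous Z := by
    have : Z = fun p => ((p.1 * Real.cos t + p.2 * Real.sin t : ℝ) : ℂ) +
        ((p.2 * Real.cos t - p.1 * Real.sin t : ℝ) : ℂ) * Complex.I := by
      ext p
      exact Complex.mk_eq_add_mul_I _ _
    rw [this]
    fun_prop
  have hZ1 : Z (Real.cos t, Real.sin t) = 1 := by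
    have := Real.cos_sq_add_sin_sq t
    apply Complex.ext
    · simp [hZ]
      nlinarith
    · simp [hZ]
      ring
  refine ⟨fun p => t + Complex.arg (Z p), ?_, ?_, ?_⟩
  · refine continuousAt_const.add (ContinuousAt.comp (g := Complex.arg) ?_ hZc.continuousAt)
    rw [hZ1]
    exact Complex.continuousAt_arg (by simp [Complex.slitPlane])
  · simp [hZ1]
  · rintro ⟨u, v⟩ h
    simp only at h
    have ht := Real.cos_sq_add_sin_sq t
    have hn : ‖Z (u, v)‖ = 1 := by
      rw [← sq_eq_sq₀ (norm_nonneg _) zero_le_one, Complex.sq_norm, Complex.normSq_apply]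
      simp only [hZ]
      linear_combination (u ^ 2 + v ^ 2) * ht + h
    have h0 : Z (u, v) ≠ 0 := by
      intro h0
      simp [h0] at hn
    have hc : Real.cos (Complex.arg (Z (u, v))) = u * Real.cos t + v * Real.sin t := by
      rw [Complex.cos_arg h0, hn, div_one]
    have hs : Real.sin (Complex.arg (Z (u, v))) = v * Real.cos t - u * Real.sin t := by
      rw [Complex.sin_arg, hn, div_one]
    simp only [Real.cos_add, Real.sin_add, hc, hs]
    constructor
    · linear_combination u * ht
    · linear_combination v * ht

theorem exists_angleState_eq {x : VoltageState} (hx : ∀ i, x.1 i ^ 2 + x.2 i ^ 2 = 1) :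
    ∃ θ, angleState θ = x := by
  choose θ h1 h2 using fun i => exists_cos_sin (hx i)
  exact ⟨θ, Prod.ext (funext h1) (funext h2)⟩

/-- Phase angles are local coordinates on the torus of unit voltages, so bounds on the number of
zeros in angle space carry over to states. -/
theorem exists_nhds_angleState {θ : Fin 3 → ℝ} {U : Set (Fin 3 → ℝ)} (hU : U ∈ 𝓝 θ) :
    ∃ V ∈ 𝓝 (angleState θ), ∀ x ∈ V, (∀ i, x.1 i ^ 2 + x.2 i ^ 2 = 1) →
      ∃ θ' ∈ U, angleState θ' = x := by
  choose Θ hc h0 h using fun i => exists_angle_lift (θ i)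
  set L : VoltageState → Fin 3 → ℝ := fun x i => Θ i (x.1 i, x.2 i)
  have hL : ContinuousAt L (angleState θ) := by
    refine continuousAt_pi.2 fun i => ?_
    refine ContinuousAt.comp (g := Θ i) (f := fun x : VoltageState => (x.1 i, x.2 i)) (hc i) ?_
    fun_prop
  have hL0 : L (angleState θ) = θ := funext fun i => h0 i
  refine ⟨L ⁻¹' U, hL.preimage_mem_nhds (by rwa [hL0]), fun x hx hu => ⟨L x, hx, ?_⟩⟩
  exact Prod.ext (funext fun i => (h i (x.1 i, x.2 i) (hu i)).1)
    (funext fun i => (h i (x.1 i, x.2 i) (hu i)).2)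

theorem exists_nhds_encard_realSolutions_le {q : (Line → ℝ) × (Fin 3 → ℝ)} {θ : Fin 3 → ℝ}
    {U : Set (Fin 3 → ℝ)} (hU : U ∈ 𝓝 θ) {n : ℕ∞}
    (h : ∀ᶠ q' in 𝓝 q, {θ' | θ' ∈ U ∧ mismatch q' θ' = 0}.encard ≤ n) :
    ∃ V ∈ 𝓝 (angleState θ), ∀ᶠ q' in 𝓝 q, (V ∩ realSolutions q'.1 q'.2).encard ≤ n := by
  obtain ⟨V, hV, hVU⟩ := exists_nhds_angleState hU
  refine ⟨V, hV, ?_⟩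
  filter_upwards [h] with q' hq'
  refine le_trans (encard_le_encard ?_) ((encard_image_le angleState _).trans hq')
  rintro x ⟨hxV, hx⟩
  obtain ⟨θ', hθ', rfl⟩ := hVU x hxV (unit_of_mem_realSolutions hx)
  exact ⟨θ', ⟨hθ', (angleState_mem_iff q' θ').1 hx⟩, rfl⟩

/-- The torus of states with unit voltages. -/
def voltageTorus : Set VoltageState := {x | ∀ i, x.1 i ^ 2 + x.2 i ^ 2 = 1}

theorem isCompact_voltageTorus : IsCompact voltageTorus := by
  have hcl : IsClosed voltageTorus := by
    simp only [voltageTorus, ofPred_forall]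
    exact isClosed_iInter fun i => isClosed_eq (by fun_prop) (by fun_prop)
  have hsub : voltageTorus ⊆ (Set.univ.pi fun _ => Icc (-1 : ℝ) 1) ×ˢ
      (Set.univ.pi fun _ => Icc (-1 : ℝ) 1) := by
    intro x hx
    refine ⟨fun i _ => ?_, fun i _ => ?_⟩
    · exact abs_le.1 (abs_le_of_sq_le_sq (by nlinarith [hx i, sq_nonneg (x.2 i)]) zero_le_one)
    · exact abs_le.1 (abs_le_of_sq_le_sq (by nlinarith [hx i, sq_nonneg (x.1 i)]) zero_le_one)
  exact ((isCompact_univ_pi fun _ => isCompact_Icc).prod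
    (isCompact_univ_pi fun _ => isCompact_Icc)).of_isClosed_subset hcl hsub

theorem realSolutions_subset_voltageTorus (b : Line → ℝ) (P : Fin 3 → ℝ) :
    realSolutions b P ⊆ voltageTorus := fun _ hx => unit_of_mem_realSolutions hx

theorem continuous_busVd (k : Fin 4) : Continuous fun x : VoltageState => busVd x k := by
  refine Fin.cases ?_ (fun j => ?_) k
  · simpa [busVd] using continuous_const
  · simp only [busVd, Fin.cons_succ]
    fun_prop

theorem continuous_busVq (k : Fin 4) : Continuous fun x : VoltageState => busVq x k := by
  refine Fin.cases ?_ (fun j => ?_) k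
  · simpa [busVq] using continuous_const
  · simp only [busVq, Fin.cons_succ]
    fun_prop

/-- Ensures that, under small perturbations, solutions appear only near the unperturbed ones. -/
theorem isClosed_realSolutions_graph :
    IsClosed {p : ((Line → ℝ) × (Fin 3 → ℝ)) × VoltageState | p.2 ∈ realSolutions p.1.1 p.1.2} := by
  have hset : {p : ((Line → ℝ) × (Fin 3 → ℝ)) × VoltageState | p.2 ∈ realSolutions p.1.1 p.1.2} =
      ⋂ i : Fin 3, {p | ∑ k : Fin 4, susceptance p.1.1 i.succ k *
        (busVd p.2 k * busVq p.2 i.succ - busVd p.2 i.succ * busVq p.2 k) = p.1.2 i} ∩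
        {p | busVd p.2 i.succ ^ 2 + busVq p.2 i.succ ^ 2 = 1} := by
    ext p
    simp [realSolutions]
  rw [hset]
  refine isClosed_iInter fun i => IsClosed.inter (isClosed_eq ?_ (by fun_prop))
    (isClosed_eq ?_ continuous_const)
  · refine continuous_finsetSum _ fun k _ => ?_
    refine ((continuous_susceptance i.succ k).comp (continuous_fst.comp continuous_fst)).mul ?_
    exact (((continuous_busVd k).comp continuous_snd).mul
      ((continuous_busVq i.succ).comp continuous_snd)).sub
      (((continuous_busVd i.succ).comp continuous_snd).mul
      ((continuous_busVq k).comp continuous_snd))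
  · exact (((continuous_busVd i.succ).comp continuous_snd).pow 2).add
      (((continuous_busVq i.succ).comp continuous_snd).pow 2)

/-! ### The network without the line `{2, 3}` and its four branches -/

/-- The solution set for zero injections when buses `2` and `3` are not connected. -/
def reducedSolutions (c a d f g : ℝ) : Set VoltageState :=
  {x | c * x.2 0 + d * (x.1 1 * x.2 0 - x.1 0 * x.2 1) + g * (x.1 2 * x.2 0 - x.1 0 * x.2 2) = 0 ∧
    a * x.2 1 + d * (x.1 0 * x.2 1 - x.1 1 * x.2 0) = 0 ∧
    f * x.2 2 + g * (x.1 0 * x.2 2 - x.1 2 * x.2 0) = 0 ∧ ∀ i, x.1 i ^ 2 + x.2 i ^ 2 = 1}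

theorem realSolutions_eq_reducedSolutions {b : Line → ℝ} (hb : susceptance b 2 3 = 0) :
    realSolutions b 0 = reducedSolutions (susceptance b 0 1) (susceptance b 0 2)
      (susceptance b 1 2) (susceptance b 0 3) (susceptance b 1 3) := by
  ext x
  have key : ∀ θ, angleState θ ∈ realSolutions b 0 ↔ angleState θ ∈
      reducedSolutions (susceptance b 0 1) (susceptance b 0 2)
      (susceptance b 1 2) (susceptance b 0 3) (susceptance b 1 3) := by
    intro θ
    have h := angleState_mem_iff (b, 0) θ
    simp only at h
    rw [h, funext_iff, Fin.forall_fin_succ, Fin.forall_fin_succ, Fin.forall_fin_succ]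
    change mismatch _ _ 0 = 0 ∧ mismatch _ _ 1 = 0 ∧ mismatch _ _ 2 = 0 ∧ _ ↔ _
    rw [mismatch_zero, mismatch_one, mismatch_two]
    simp only [hb, Real.sin_sub, reducedSolutions, angleState, mem_ofPred_eq, Pi.zero_apply,
      IsEmpty.forall_iff, and_true, Real.cos_sq_add_sin_sq, implies_true, zero_mul, add_zero,
      sub_zero]
    refine and_congr ?_ (and_congr ?_ ?_) <;> refine Eq.congr ?_ rfl <;> ring
  constructor
  · intro hx
    obtain ⟨θ, rfl⟩ := exists_angleState_eq (unit_of_mem_realSolutions hx)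
    exact (key θ).1 hx
  · intro hx
    obtain ⟨θ, rfl⟩ := exists_angleState_eq hx.2.2.2
    exact (key θ).2 hx

/-- The squared modulus `|a + d e^{iφ}|²` as a function of `cos φ`. -/
def phasorNormSq (a d y : ℝ) : ℝ := a ^ 2 + d ^ 2 + 2 * (a * d) * y

theorem phasorNormSq_cos (a d t : ℝ) : phasorNormSq a d (Real.cos t) =
    (a + d * Real.cos t) ^ 2 + (d * Real.sin t) ^ 2 := by
  unfold phasorNormSq
  linear_combination (-d ^ 2) * Real.cos_sq_add_sin_sq t

/-- The power balance at bus `1` along the branch `(s, s')` of solutions of the power balances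
at the buses `2` and `3`. -/
noncomputable def branchBalance (c a d f g s s' t : ℝ) : ℝ :=
  Real.sin t * (c + s * (a * d) / √(phasorNormSq a d (Real.cos t)) +
    s' * (f * g) / √(phasorNormSq f g (Real.cos t)))

/-- The prescribed cosine and sine form a unit vector, because `s ^ 2 = 1`, and this vector moves
continuously as long as the phasor is nonzero; so its angle can be followed. -/
theorem exists_branch_lift {a d φ w s : ℝ} (hα : 0 < phasorNormSq a d (Real.cos φ))
    (hs : s ^ 2 = 1)
    (hc : Real.cos w = s * (a + d * Real.cos φ) / √(phasorNormSq a d (Real.cos φ)))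
    (hsn : Real.sin w = s * (d * Real.sin φ) / √(phasorNormSq a d (Real.cos φ))) :
    ∃ γ : ℝ → ℝ, ContinuousAt γ φ ∧ γ φ = w ∧ ∀ᶠ t in 𝓝 φ,
      0 < phasorNormSq a d (Real.cos t) ∧
      Real.cos (γ t) = s * (a + d * Real.cos t) / √(phasorNormSq a d (Real.cos t)) ∧
      Real.sin (γ t) = s * (d * Real.sin t) / √(phasorNormSq a d (Real.cos t)) := by
  obtain ⟨Θ, hΘc, hΘ0, hΘ⟩ := exists_angle_lift w
  set Z : ℝ → ℝ × ℝ := fun t => (s * (a + d * Real.cos t) / √(phasorNormSq a d (Real.cos t)),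
    s * (d * Real.sin t) / √(phasorNormSq a d (Real.cos t))) with hZ
  have hαc : Continuous fun t => phasorNormSq a d (Real.cos t) := by
    unfold phasorNormSq
    fun_prop
  have hZφ : Z φ = (Real.cos w, Real.sin w) := by simp only [hZ, hc, hsn]
  have hne : √(phasorNormSq a d (Real.cos φ)) ≠ 0 := (Real.sqrt_pos.2 hα).ne'
  have hZc : ContinuousAt Z φ := by
    exact ContinuousAt.prodMk (ContinuousAt.div (by fun_prop) hαc.sqrt.continuousAt hne)
      (ContinuousAt.div (by fun_prop) hαc.sqrt.continuousAt hne)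
  refine ⟨fun t => Θ (Z t), ?_, ?_, ?_⟩
  · refine ContinuousAt.comp (g := Θ) ?_ hZc
    rwa [hZφ]
  · simp only [hZφ, hΘ0]
  · filter_upwards [continuousAt_const.eventually_lt hαc.continuousAt hα] with t ht
    refine ⟨ht, hΘ (Z t) ?_⟩
    simp only [hZ]
    rw [div_pow, div_pow, Real.sq_sqrt ht.le, ← add_div, div_eq_one_iff_eq ht.ne',
      phasorNormSq_cos]
    linear_combination ((a + d * Real.cos t) ^ 2 + (d * Real.sin t) ^ 2) * hs

theorem contDiff_vec₃ : ContDiff ℝ ω (fun p : ℝ × (Fin 2 → ℝ) => ![p.1, p.2 0, p.2 1]) := by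
  refine contDiff_pi.2 fun i => ?_
  fin_cases i <;> simp <;> fun_prop

/-! ### How many nearby solutions a solution accounts for -/

section LocalCount

variable {b : Line → ℝ} (hb : susceptance b 2 3 = 0)
include hb

theorem hasFDerivAt_mismatch (θ : Fin 3 → ℝ) :
    HasFDerivAt (mismatch (b, 0)) (Matrix.toLin' !![
      susceptance b 0 1 * Real.cos (θ 0) + susceptance b 1 2 * Real.cos (θ 0 - θ 1) +
        susceptance b 1 3 * Real.cos (θ 0 - θ 2),
      -(susceptance b 1 2 * Real.cos (θ 0 - θ 1)), -(susceptance b 1 3 * Real.cos (θ 0 - θ 2));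
      -(susceptance b 1 2 * Real.cos (θ 1 - θ 0)),
      susceptance b 0 2 * Real.cos (θ 1) + susceptance b 1 2 * Real.cos (θ 1 - θ 0), 0;
      -(susceptance b 1 3 * Real.cos (θ 2 - θ 0)), 0,
      susceptance b 0 3 * Real.cos (θ 2) + susceptance b 1 3 * Real.cos (θ 2 - θ 0)
      ]).toContinuousLinearMap θ := by
  have hp : ∀ i : Fin 3, HasFDerivAt (fun θ : Fin 3 → ℝ => θ i)
    (ContinuousLinearMap.proj (R := ℝ) (φ := fun _ => ℝ) i) θ := fun i => hasFDerivAt_apply i θ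
  have h0 : ∀ k i, HasFDerivAt (fun θ : Fin 3 → ℝ => k * Real.sin (θ i)) _ θ :=
    fun k i => (hp i).sin.const_mul k
  have h1 : ∀ k i j, HasFDerivAt (fun θ : Fin 3 → ℝ => k * Real.sin (θ i - θ j)) _ θ :=
    fun k i j => ((hp i).sub (hp j)).sin.const_mul k
  refine hasFDerivAt_pi'.2 fun i => ?_
  fin_cases i
  · have : (fun θ => mismatch (b, 0) θ 0) = fun θ => susceptance b 0 1 * Real.sin (θ 0) +
        susceptance b 1 2 * Real.sin (θ 0 - θ 1) + susceptance b 1 3 * Real.sin (θ 0 - θ 2) := by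
      ext θ
      simp [mismatch_zero]
    simp only [Fin.zero_eta]
    rw [this]
    refine (((h0 _ _).add (h1 _ _ _)).add (h1 _ _ _)).congr_fderiv ?_
    ext v
    simp [dotProduct, Fin.sum_univ_three]
    ring
  · have : (fun θ => mismatch (b, 0) θ 1) = fun θ => susceptance b 0 2 * Real.sin (θ 1) +
        susceptance b 1 2 * Real.sin (θ 1 - θ 0) := by
      ext θ
      simp [mismatch_one, hb]
    simp only [Fin.mk_one]
    rw [this]
    refine ((h0 _ _).add (h1 _ _ _)).congr_fderiv ?_
    ext v
    simp [dotProduct, Fin.sum_univ_three]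
    ring
  · have : (fun θ => mismatch (b, 0) θ 2) = fun θ => susceptance b 0 3 * Real.sin (θ 2) +
        susceptance b 1 3 * Real.sin (θ 2 - θ 0) := by
      ext θ
      simp [mismatch_two, hb]
    simp only [Fin.reduceFinMk]
    rw [this]
    refine ((h0 _ _).add (h1 _ _ _)).congr_fderiv ?_
    ext v
    simp [dotProduct, Fin.sum_univ_three]
    ring

end LocalCount

/-- The Jacobian determinant of the power flow equations, expressed by voltages. -/
def jacobianDet (c a d f g : ℝ) (x : VoltageState) : ℝ :=
  let D := d * (x.1 0 * x.1 1 + x.2 0 * x.2 1)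
  let G := g * (x.1 0 * x.1 2 + x.2 0 * x.2 2)
  (c * x.1 0 + D + G) * (a * x.1 1 + D) * (f * x.1 2 + G) - D ^ 2 * (f * x.1 2 + G) -
    G ^ 2 * (a * x.1 1 + D)

section LocalCount

variable {b : Line → ℝ} (hb : susceptance b 2 3 = 0)
include hb

theorem exists_invertible_fderiv {θ : Fin 3 → ℝ}
    (hdet : jacobianDet (susceptance b 0 1) (susceptance b 0 2) (susceptance b 1 2)
      (susceptance b 0 3) (susceptance b 1 3) (angleState θ) ≠ 0) :
    ∃ A : (Fin 3 → ℝ) →L[ℝ] (Fin 3 → ℝ), A.IsInvertible ∧ HasFDerivAt (mismatch (b, 0)) A θ := by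
  refine ⟨_, isInvertible_toLin'_of_det_ne_zero _ ?_, hasFDerivAt_mismatch hb θ⟩
  convert hdet using 1
  rw [Matrix.det_fin_three]
  simp [jacobianDet, angleState, Real.cos_sub]
  ring

theorem local_encard_le_one {x : VoltageState} (hx : x ∈ realSolutions b 0)
    (hdet : jacobianDet (susceptance b 0 1) (susceptance b 0 2) (susceptance b 1 2)
      (susceptance b 0 3) (susceptance b 1 3) x ≠ 0) :
    ∃ V ∈ 𝓝 x, ∀ᶠ q in 𝓝 (b, (0 : Fin 3 → ℝ)), (V ∩ realSolutions q.1 q.2).encard ≤ 1 := by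
  obtain ⟨θ, rfl⟩ := exists_angleState_eq (unit_of_mem_realSolutions hx)
  obtain ⟨A, hA, hder⟩ := exists_invertible_fderiv hb hdet
  obtain ⟨U, hU, h⟩ := eventually_encard_zeros_le_one
    (H := fun p : ((Line → ℝ) × (Fin 3 → ℝ)) × (Fin 3 → ℝ) => mismatch p.1 p.2)
    contDiff_mismatch.contDiffAt ((angleState_mem_iff (b, 0) θ).1 hx) hA hder
  exact exists_nhds_encard_realSolutions_le hU h

theorem eventually_nonempty_inter {x : VoltageState} (hx : x ∈ realSolutions b 0)
    (hdet : jacobianDet (susceptance b 0 1) (susceptance b 0 2) (susceptance b 1 2)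
      (susceptance b 0 3) (susceptance b 1 3) x ≠ 0) {V : Set VoltageState} (hV : V ∈ 𝓝 x) :
    ∀ᶠ q in 𝓝 (b, (0 : Fin 3 → ℝ)), (V ∩ realSolutions q.1 q.2).Nonempty := by
  obtain ⟨θ, rfl⟩ := exists_angleState_eq (unit_of_mem_realSolutions hx)
  obtain ⟨A, hA, hder⟩ := exists_invertible_fderiv hb hdet
  have := eventually_exists_zero
    (H := fun p : ((Line → ℝ) × (Fin 3 → ℝ)) × (Fin 3 → ℝ) => mismatch p.1 p.2)
    contDiff_mismatch.contDiffAt ((angleState_mem_iff (b, 0) θ).1 hx) hA hder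
    (continuous_angleState.continuousAt.preimage_mem_nhds hV)
  filter_upwards [this] with q hq
  obtain ⟨θ', h1, h2⟩ := hq
  exact ⟨_, h1, (angleState_mem_iff q θ').2 h2⟩

/-- In the angles of buses 2 and 3 the balances at these buses have a diagonal Jacobian, since the
two buses are not joined. Its entries are the signed lengths of the two phasors, hence nonzero. Both
angles can thus be eliminated, and what remains at bus 1 is `branchBalance`. -/
theorem local_encard_le_order {θ : Fin 3 → ℝ} {s s' : ℝ}
    (hs : s ^ 2 = 1) (hs' : s' ^ 2 = 1)
    (hα : 0 < phasorNormSq (susceptance b 0 2) (susceptance b 1 2) (Real.cos (θ 0)))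
    (hβ : 0 < phasorNormSq (susceptance b 0 3) (susceptance b 1 3) (Real.cos (θ 0)))
    (hc : Real.cos (θ 1) = s * (susceptance b 0 2 + susceptance b 1 2 * Real.cos (θ 0)) /
      √(phasorNormSq (susceptance b 0 2) (susceptance b 1 2) (Real.cos (θ 0))))
    (hsn : Real.sin (θ 1) = s * (susceptance b 1 2 * Real.sin (θ 0)) /
      √(phasorNormSq (susceptance b 0 2) (susceptance b 1 2) (Real.cos (θ 0))))
    (hc' : Real.cos (θ 2) = s' * (susceptance b 0 3 + susceptance b 1 3 * Real.cos (θ 0)) /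
      √(phasorNormSq (susceptance b 0 3) (susceptance b 1 3) (Real.cos (θ 0))))
    (hsn' : Real.sin (θ 2) = s' * (susceptance b 1 3 * Real.sin (θ 0)) /
      √(phasorNormSq (susceptance b 0 3) (susceptance b 1 3) (Real.cos (θ 0)))) :
    ∃ V ∈ 𝓝 (angleState θ), ∀ᶠ q in 𝓝 (b, (0 : Fin 3 → ℝ)),
      (V ∩ realSolutions q.1 q.2).encard ≤ analyticOrderAt (branchBalance (susceptance b 0 1)
        (susceptance b 0 2) (susceptance b 1 2) (susceptance b 0 3) (susceptance b 1 3) s s')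
        (θ 0) := by
  set c := susceptance b 0 1 with hcdef
  set a := susceptance b 0 2 with hadef
  set d := susceptance b 1 2 with hddef
  set f := susceptance b 0 3 with hfdef
  set g := susceptance b 1 3 with hgdef
  obtain ⟨w, hwc, hw0, hw⟩ := exists_branch_lift hα hs hc hsn
  obtain ⟨x, hxc, hx0, hx⟩ := exists_branch_lift hβ hs' hc' hsn'
  set H : (((Line → ℝ) × (Fin 3 → ℝ)) × ℝ) × (Fin 2 → ℝ) → Fin 2 → ℝ := fun p =>
    ![mismatch p.1.1 ![p.1.2, p.2 0, p.2 1] 1, mismatch p.1.1 ![p.1.2, p.2 0, p.2 1] 2] with hH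
  set F : (((Line → ℝ) × (Fin 3 → ℝ)) × ℝ) × (Fin 2 → ℝ) → ℝ := fun p =>
    mismatch p.1.1 ![p.1.2, p.2 0, p.2 1] 0 with hF
  have hm : ContDiff ℝ ω (fun p : (((Line → ℝ) × (Fin 3 → ℝ)) × ℝ) × (Fin 2 → ℝ) =>
      mismatch p.1.1 ![p.1.2, p.2 0, p.2 1]) :=
    contDiff_mismatch.comp ((contDiff_fst.comp contDiff_fst).prodMk
      (contDiff_vec₃.comp ((contDiff_snd.comp contDiff_fst).prodMk contDiff_snd)))
  have hmi := contDiff_pi.1 hm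
  have hHc : ContDiff ℝ ω H := by
    refine contDiff_pi.2 fun i => ?_
    fin_cases i
    · exact hmi 1
    · exact hmi 2
  have hγc : ContinuousAt (fun t => ![w t, x t]) (θ 0) := by
    refine continuousAt_pi.2 fun i => ?_
    fin_cases i
    · exact hwc
    · exact hxc
  have hzero : ∀ᶠ t in 𝓝 (θ 0), H (((b, 0), t), ![w t, x t]) = 0 := by
    filter_upwards [hw, hx] with t ht ht'
    ext i
    fin_cases i
    · simp only [hH, Fin.zero_eta, Matrix.cons_val_zero, mismatch_one, Real.sin_sub]
      simp only [hb, Pi.zero_apply, Matrix.cons_val_zero, Matrix.cons_val_one, ht.2.1, ht.2.2,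
        ← hadef, ← hddef]
      ring
    · simp only [hH, Fin.mk_one, Matrix.cons_val_one, mismatch_two, Real.sin_sub]
      simp only [hb, Pi.zero_apply, Matrix.cons_val_zero, Matrix.cons_val,
        ht'.2.1, ht'.2.2, ← hfdef, ← hgdef]
      ring
  -- In `d sin (φ - w)` the terms in `d ^ 2` cancel, which leaves `s a d sin φ / |A|`; the other
  -- branch is alike.
  have hFb : (fun t => F (((b, 0), t), ![w t, x t])) =ᶠ[𝓝 (θ 0)] branchBalance c a d f g s s' := by
    filter_upwards [hw, hx] with t ht ht'
    simp only [hF, mismatch_zero, Real.sin_sub]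
    simp only [Pi.zero_apply, Matrix.cons_val_zero, Matrix.cons_val_one, Matrix.cons_val,
      ht.2.1, ht.2.2, ht'.2.1, ht'.2.2, ← hcdef, ← hddef, ← hgdef, branchBalance]
    ring
  have hder : HasFDerivAt (fun y => H (((b, 0), θ 0), y)) (Matrix.toLin' !![
      a * Real.cos (θ 1) + d * Real.cos (θ 1 - θ 0), 0;
      0, f * Real.cos (θ 2) + g * Real.cos (θ 2 - θ 0)]).toContinuousLinearMap
      ![w (θ 0), x (θ 0)] := by
    have hp : ∀ i : Fin 2, HasFDerivAt (fun y : Fin 2 → ℝ => y i)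
      (ContinuousLinearMap.proj (R := ℝ) (φ := fun _ => ℝ) i) ![w (θ 0), x (θ 0)] :=
      fun i => hasFDerivAt_apply i _
    refine hasFDerivAt_pi'.2 fun i => ?_
    fin_cases i
    · have : (fun y => H (((b, 0), θ 0), y) 0) = fun y =>
          a * Real.sin (y 0) + d * Real.sin (y 0 - θ 0) := by
        ext y
        simp [hH, mismatch_one, hb, hadef, hddef]
      simp only [Fin.zero_eta]
      rw [this]
      refine (((hp 0).sin.const_mul a).add (((hp 0).sub_const (θ 0)).sin.const_mul d)).congr_fderiv
        ?_
      ext v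
      simp [dotProduct, hw0]
      ring
    · have : (fun y => H (((b, 0), θ 0), y) 1) = fun y =>
          f * Real.sin (y 1) + g * Real.sin (y 1 - θ 0) := by
        ext y
        simp [hH, mismatch_two, hb, hfdef, hgdef]
      simp only [Fin.mk_one]
      rw [this]
      refine (((hp 1).sin.const_mul f).add (((hp 1).sub_const (θ 0)).sin.const_mul g)).congr_fderiv
        ?_
      ext v
      simp [dotProduct, hx0]
      ring
  -- The expression is the component of the phasor along the bus voltage, that is, `s` times the
  -- length of the phasor.
  have hdiag : ∀ {a d w s : ℝ}, s ^ 2 = 1 → 0 < phasorNormSq a d (Real.cos (θ 0)) →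
      Real.cos w = s * (a + d * Real.cos (θ 0)) / √(phasorNormSq a d (Real.cos (θ 0))) →
      Real.sin w = s * (d * Real.sin (θ 0)) / √(phasorNormSq a d (Real.cos (θ 0))) →
      a * Real.cos w + d * Real.cos (w - θ 0) ≠ 0 := by
    intro a d w s hs hα hc hsn
    have hs0 : s ≠ 0 := by rintro rfl; norm_num at hs
    have : a * Real.cos w + d * Real.cos (w - θ 0) =
        s * (phasorNormSq a d (Real.cos (θ 0)) / √(phasorNormSq a d (Real.cos (θ 0)))) := by
      rw [Real.cos_sub, hc, hsn]
      generalize √(phasorNormSq a d (Real.cos (θ 0))) = r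
      rw [phasorNormSq_cos]
      ring
    rw [this]
    exact mul_ne_zero hs0 (div_pos hα (Real.sqrt_pos.2 hα)).ne'
  have hinv := isInvertible_toLin'_of_det_ne_zero !![
      a * Real.cos (θ 1) + d * Real.cos (θ 1 - θ 0), 0;
      0, f * Real.cos (θ 2) + g * Real.cos (θ 2 - θ 0)] (by
    rw [Matrix.det_fin_two_of]
    simpa using ⟨hdiag hs hα hc hsn, hdiag hs' hβ hc' hsn'⟩)
  obtain ⟨U, hU, hcount⟩ := eventually_encard_zeros_le_order (H := H) (F := F) (q := (b, 0))
    (t := θ 0) (γ := fun t => ![w t, x t]) hHc.contDiffAt (hmi 0).contDiffAt hγc hzero hinv hder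
  rw [analyticOrderAt_congr hFb] at hcount
  set N : (Fin 3 → ℝ) → ℝ × (Fin 2 → ℝ) := fun θ' => (θ' 0, ![θ' 1, θ' 2]) with hN
  have hNc : Continuous N := by
    refine Continuous.prodMk (by fun_prop) (continuous_pi fun i => ?_)
    fin_cases i <;> simp <;> fun_prop
  have hvec : ∀ θ' : Fin 3 → ℝ, ![θ' 0, θ' 1, θ' 2] = θ' := fun θ' => by
    ext i
    fin_cases i <;> rfl
  have hNU : N ⁻¹' U ∈ 𝓝 θ := by
    refine hNc.continuousAt.preimage_mem_nhds ?_
    simpa [hN, hw0, hx0] using hU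
  refine exists_nhds_encard_realSolutions_le hNU ?_
  filter_upwards [hcount] with q hq
  refine le_trans (encard_le_encard_of_injOn (f := N) ?_ ?_) hq
  · rintro θ' ⟨hθU, hθ0⟩
    refine ⟨hθU, ?_, ?_⟩
    · ext i
      fin_cases i <;> simp [hH, hN, hvec, hθ0]
    · simp [hF, hN, hvec, hθ0]
  · intro θ₁ _ θ₂ _ h12
    simp only [hN, Prod.mk.injEq] at h12
    rw [← hvec θ₁, ← hvec θ₂, h12.1]
    have h1 := congrFun h12.2 0
    have h2 := congrFun h12.2 1
    simp only [Matrix.cons_val_zero, Matrix.cons_val_one] at h1 h2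
    rw [h1, h2]

end LocalCount

/-! ### Orders of vanishing of the branch balances -/

section Order

theorem analyticOrderAt_sin (t : ℝ) :
    analyticOrderAt Real.sin t = if Real.sin t = 0 then 1 else 0 := by
  split_ifs with h
  · refine AnalyticAt.analyticOrderAt_eq_one_of_zero_deriv_ne_zero Real.analyticAt_sin h ?_
    rw [Real.deriv_sin]
    intro h'
    have := Real.cos_sq_add_sin_sq t
    rw [h, h'] at this
    norm_num at this
  · exact Real.analyticAt_sin.analyticOrderAt_eq_zero.2 h

/-- The derivative is `-sin`, so the order is two at multiples of `π` and one elsewhere. -/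
theorem analyticOrderAt_cos_sub (t : ℝ) :
    analyticOrderAt (fun t' => Real.cos t' - Real.cos t) t =
      (if Real.sin t = 0 then 1 else 0) + 1 := by
  rw [← (Real.analyticAt_cos (x := t)).analyticOrderAt_deriv_add_one, Real.deriv_cos', ← analyticOrderAt_sin]
  congr 1
  exact analyticOrderAt_neg (f := Real.sin)

theorem Polynomial.analyticAt_eval_comp {p : Polynomial ℝ} {u : ℝ → ℝ} {t : ℝ}
    (hu : AnalyticAt ℝ u t) : AnalyticAt ℝ (fun t' => p.eval (u t')) t := by
  induction p using Polynomial.induction_on' with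
  | add p q hp hq =>
    simp only [Polynomial.eval_add]
    exact hp.add hq
  | monomial n a =>
    simp only [Polynomial.eval_monomial]
    exact analyticAt_const.mul (hu.pow n)

/-- A root in `(-1, 1)` is attained at two angles of the circle to its own multiplicity, a root `±1`
at one angle to twice its multiplicity; either way it contributes twice its multiplicity. -/
theorem Polynomial.analyticOrderAt_eval_cos {p : Polynomial ℝ} (hp : p ≠ 0) (t : ℝ) :
    analyticOrderAt (fun t' => p.eval (Real.cos t')) t =
      p.rootMultiplicity (Real.cos t) * ((if Real.sin t = 0 then 1 else 0) + 1) := by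
  obtain ⟨r, hr, hr0⟩ := Polynomial.exists_eq_pow_rootMultiplicity_mul_and_not_dvd p hp (Real.cos t)
  have hev : r.eval (Real.cos t) ≠ 0 := fun h => hr0 (Polynomial.dvd_iff_isRoot.2 h)
  have hfun : (fun t' => p.eval (Real.cos t')) =
      (fun t' => Real.cos t' - Real.cos t) ^ p.rootMultiplicity (Real.cos t) *
        fun t' => r.eval (Real.cos t') := by
    ext t'
    conv_lhs => rw [hr]
    simp
  have h1 : AnalyticAt ℝ (fun t' => Real.cos t' - Real.cos t) t :=
    Real.analyticAt_cos.sub analyticAt_const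
  have h2 : AnalyticAt ℝ (fun t' => r.eval (Real.cos t')) t :=
    Polynomial.analyticAt_eval_comp Real.analyticAt_cos
  rw [hfun, analyticOrderAt_mul (h1.pow _) h2, analyticOrderAt_pow h1, analyticOrderAt_cos_sub,
    h2.analyticOrderAt_eq_zero.2 hev, add_zero, nsmul_eq_mul]

end Order

open Polynomial in
/-- The polynomial `phasorNormSq a d`. -/
noncomputable def phasorPoly (a d : ℝ) : ℝ[X] := C (2 * (a * d)) * X + C (a ^ 2 + d ^ 2)

open Polynomial in
/-- The product of `c + s p/|A| + s' q/|B|` over the signs, up to the factor `|A|⁴|B|⁴`. -/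
noncomputable def signProduct (c a d f g : ℝ) : ℝ[X] :=
  (C (c ^ 2) * phasorPoly a d * phasorPoly f g - C ((a * d) ^ 2) * phasorPoly f g -
    C ((f * g) ^ 2) * phasorPoly a d) ^ 2 -
    C (4 * (a * d) ^ 2 * (f * g) ^ 2) * phasorPoly a d * phasorPoly f g

theorem eval_phasorPoly (a d y : ℝ) : (phasorPoly a d).eval y = phasorNormSq a d y := by
  simp only [phasorPoly, phasorNormSq, Polynomial.eval_add, Polynomial.eval_mul, Polynomial.eval_C,
    Polynomial.eval_X]
  ring

theorem eval_signProduct (c a d f g y : ℝ) : (signProduct c a d f g).eval y =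
    (c ^ 2 * phasorNormSq a d y * phasorNormSq f g y - (a * d) ^ 2 * phasorNormSq f g y -
      (f * g) ^ 2 * phasorNormSq a d y) ^ 2 -
      4 * (a * d) ^ 2 * (f * g) ^ 2 * phasorNormSq a d y * phasorNormSq f g y := by
  simp only [signProduct, Polynomial.eval_sub, Polynomial.eval_mul, Polynomial.eval_pow,
    Polynomial.eval_C, eval_phasorPoly]

theorem natDegree_signProduct_le (c a d f g : ℝ) : (signProduct c a d f g).natDegree ≤ 4 := by
  unfold signProduct phasorPoly
  compute_degree

theorem analyticAt_branchBalance {c a d f g s s' t : ℝ} (hα : 0 < phasorNormSq a d (Real.cos t))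
    (hβ : 0 < phasorNormSq f g (Real.cos t)) : AnalyticAt ℝ (branchBalance c a d f g s s') t := by
  have hsqrt : ∀ {a d : ℝ}, 0 < phasorNormSq a d (Real.cos t) →
      AnalyticAt ℝ (fun t => √(phasorNormSq a d (Real.cos t))) t := by
    intro a d h
    have h1 : AnalyticAt ℝ (fun t => phasorNormSq a d (Real.cos t)) t := by
      unfold phasorNormSq
      fun_prop
    exact AnalyticAt.comp (g := Real.sqrt) (f := fun t => phasorNormSq a d (Real.cos t))
      (Real.contDiffAt_sqrt h.ne').analyticAt h1
  unfold branchBalance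
  exact Real.analyticAt_sin.mul ((analyticAt_const.add
    (analyticAt_const.div (hsqrt hα) (Real.sqrt_pos.2 hα).ne')).add
    (analyticAt_const.div (hsqrt hβ) (Real.sqrt_pos.2 hβ).ne'))

/-- With `P = ad/|A|` and `R = fg/|B|`, the product of `c ± P ± R` is `(c² - P² - R²)² - 4 P² R²`.
Only even powers of the square roots survive. -/
theorem prod_branchBalance {c a d f g t : ℝ} (hα : 0 < phasorNormSq a d (Real.cos t))
    (hβ : 0 < phasorNormSq f g (Real.cos t)) :
    branchBalance c a d f g 1 1 t * branchBalance c a d f g 1 (-1) t *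
      branchBalance c a d f g (-1) 1 t * branchBalance c a d f g (-1) (-1) t *
      (phasorNormSq a d (Real.cos t) * phasorNormSq f g (Real.cos t)) ^ 2 =
      Real.sin t ^ 4 * (signProduct c a d f g).eval (Real.cos t) := by
  rw [eval_signProduct]
  unfold branchBalance
  have h1 := Real.sq_sqrt hα.le
  have h2 := Real.sq_sqrt hβ.le
  have h3 := (Real.sqrt_pos.2 hα).ne'
  have h4 := (Real.sqrt_pos.2 hβ).ne'
  set A := √(phasorNormSq a d (Real.cos t))
  set B := √(phasorNormSq f g (Real.cos t))
  rw [← h1, ← h2]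
  field_simp
  ring

/-- Orders add over the product in `prod_branchBalance`, whose cleared denominator does not vanish
at `t`. -/
theorem sum_analyticOrderAt_branchBalance {c a d f g t : ℝ}
    (hα : 0 < phasorNormSq a d (Real.cos t)) (hβ : 0 < phasorNormSq f g (Real.cos t))
    (hQ : signProduct c a d f g ≠ 0) :
    ∑ s ∈ ({1, -1} : Finset ℝ) ×ˢ ({1, -1} : Finset ℝ),
      analyticOrderAt (branchBalance c a d f g s.1 s.2) t =
      4 * (if Real.sin t = 0 then 1 else 0) +
      (signProduct c a d f g).rootMultiplicity (Real.cos t) *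
        ((if Real.sin t = 0 then 1 else 0) + 1) := by
  have han : ∀ s s', AnalyticAt ℝ (branchBalance c a d f g s s') t :=
    fun s s' => analyticAt_branchBalance hα hβ
  have hphc : ∀ a d, AnalyticAt ℝ (fun t => phasorNormSq a d (Real.cos t)) t := by
    intro a d
    unfold phasorNormSq
    fun_prop
  have hN : AnalyticAt ℝ
      (fun t => (phasorNormSq a d (Real.cos t) * phasorNormSq f g (Real.cos t)) ^ 2) t :=
    ((hphc a d).mul (hphc f g)).pow 2
  have hev : branchBalance c a d f g 1 1 * branchBalance c a d f g 1 (-1) *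
      branchBalance c a d f g (-1) 1 * branchBalance c a d f g (-1) (-1) *
      (fun t => (phasorNormSq a d (Real.cos t) * phasorNormSq f g (Real.cos t)) ^ 2) =ᶠ[𝓝 t]
      Real.sin ^ 4 * fun t => (signProduct c a d f g).eval (Real.cos t) := by
    filter_upwards [(hphc a d).continuousAt.eventually (lt_mem_nhds hα),
      (hphc f g).continuousAt.eventually (lt_mem_nhds hβ)] with t' h1 h2
    exact prod_branchBalance h1 h2
  have hord := analyticOrderAt_congr hev
  rw [analyticOrderAt_mul (((((han _ _).mul (han _ _)).mul (han _ _)).mul (han _ _))) hN,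
    analyticOrderAt_mul ((((han _ _).mul (han _ _)).mul (han _ _))) (han _ _),
    analyticOrderAt_mul (((han _ _).mul (han _ _))) (han _ _),
    analyticOrderAt_mul (han _ _) (han _ _),
    hN.analyticOrderAt_eq_zero.2 (pow_ne_zero 2 (mul_pos hα hβ).ne'), add_zero,
    analyticOrderAt_mul (Real.analyticAt_sin.pow 4)
      (Polynomial.analyticAt_eval_comp Real.analyticAt_cos),
    analyticOrderAt_pow Real.analyticAt_sin, analyticOrderAt_sin,
    Polynomial.analyticOrderAt_eval_cos hQ, nsmul_eq_mul] at hord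
  have hne : (1 : ℝ) ≠ -1 := by norm_num
  rw [Finset.sum_product, Finset.sum_pair hne, Finset.sum_pair hne, Finset.sum_pair hne]
  rw [← add_assoc, hord]
  norm_num

/-! ### Geometry of the solutions of the reduced system -/

section Reduced

variable {c a d f g : ℝ} {x : VoltageState}

/-- At a solution, the phasor `a + d z₁` is parallel to the voltage of a bus connected to the
buses `0` and `1` only. -/
theorem phasor_parallel (hu : ∀ i, x.1 i ^ 2 + x.2 i ^ 2 = 1) {i : Fin 3}
    (h : a * x.2 i + d * (x.1 0 * x.2 i - x.1 i * x.2 0) = 0) :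
    a + d * x.1 0 = (a * x.1 i + d * (x.1 0 * x.1 i + x.2 0 * x.2 i)) * x.1 i ∧
    d * x.2 0 = (a * x.1 i + d * (x.1 0 * x.1 i + x.2 0 * x.2 i)) * x.2 i := by
  have hi := hu i
  constructor
  · linear_combination (-(a + d * x.1 0)) * hi + x.2 i * h
  · linear_combination (-(d * x.2 0)) * hi - x.1 i * h

theorem phasorNormSq_state (hu : ∀ i, x.1 i ^ 2 + x.2 i ^ 2 = 1) (a d : ℝ) :
    phasorNormSq a d (x.1 0) = (a + d * x.1 0) ^ 2 + (d * x.2 0) ^ 2 := by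
  unfold phasorNormSq
  linear_combination (-d ^ 2) * hu 0

theorem phasorNormSq_nonneg (hu : ∀ i, x.1 i ^ 2 + x.2 i ^ 2 = 1) (a d : ℝ) :
    0 ≤ phasorNormSq a d (x.1 0) := by
  rw [phasorNormSq_state hu]
  positivity

/-- As the phasor vanishes with `a`, `d` not both zero, `d ≠ 0`; its imaginary part then forces the
voltage of bus 1 to be real. -/
theorem phasor_eq_zero (hu : ∀ i, x.1 i ^ 2 + x.2 i ^ 2 = 1) (had : a ≠ 0 ∨ d ≠ 0)
    (h : phasorNormSq a d (x.1 0) = 0) : a + d * x.1 0 = 0 ∧ d ≠ 0 ∧ x.2 0 = 0 := by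
  rw [phasorNormSq_state hu] at h
  have h1 : a + d * x.1 0 = 0 := by
    have := sq_nonneg (a + d * x.1 0)
    have := sq_nonneg (d * x.2 0)
    exact pow_eq_zero_iff (two_ne_zero) |>.1 (by linarith)
  have h2 : d * x.2 0 = 0 := by
    have := sq_nonneg (a + d * x.1 0)
    have := sq_nonneg (d * x.2 0)
    exact pow_eq_zero_iff (two_ne_zero) |>.1 (by linarith)
  have hd : d ≠ 0 := by
    rintro rfl
    simp at h1 had
    exact had h1
  exact ⟨h1, hd, (mul_eq_zero.1 h2).resolve_left hd⟩

/-- The component of the phasor `a + d z₁` along the voltage of bus `i + 1`. -/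
def phasorComponent (a d : ℝ) (i : Fin 3) (x : VoltageState) : ℝ :=
  a * x.1 i + d * (x.1 0 * x.1 i + x.2 0 * x.2 i)

/-- A vector parallel to a unit vector has, up to sign, its length as component. -/
theorem phasorComponent_sq (hu : ∀ i, x.1 i ^ 2 + x.2 i ^ 2 = 1) {i : Fin 3}
    (h : a * x.2 i + d * (x.1 0 * x.2 i - x.1 i * x.2 0) = 0) :
    phasorComponent a d i x ^ 2 = phasorNormSq a d (x.1 0) := by
  obtain ⟨h1, h2⟩ := phasor_parallel hu h
  rw [phasorNormSq_state hu, h1, h2]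
  unfold phasorComponent
  linear_combination (-(a * x.1 i + d * (x.1 0 * x.1 i + x.2 0 * x.2 i)) ^ 2) * hu i

/-- The sign of a branch. -/
noncomputable def branchSign (a d : ℝ) (i : Fin 3) (x : VoltageState) : ℝ :=
  phasorComponent a d i x / √(phasorNormSq a d (x.1 0))

theorem branchSign_spec (hu : ∀ i, x.1 i ^ 2 + x.2 i ^ 2 = 1) {i : Fin 3}
    (h : a * x.2 i + d * (x.1 0 * x.2 i - x.1 i * x.2 0) = 0)
    (hα : 0 < phasorNormSq a d (x.1 0)) :
    branchSign a d i x ^ 2 = 1 ∧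
    x.1 i = branchSign a d i x * (a + d * x.1 0) / √(phasorNormSq a d (x.1 0)) ∧
    x.2 i = branchSign a d i x * (d * x.2 0) / √(phasorNormSq a d (x.1 0)) := by
  have hsq := phasorComponent_sq hu h
  obtain ⟨h1, h2⟩ := phasor_parallel hu h
  have hs := Real.sq_sqrt hα.le
  have hs0 := (Real.sqrt_pos.2 hα).ne'
  have h1' : a + d * x.1 0 = phasorComponent a d i x * x.1 i := h1
  have h2' : d * x.2 0 = phasorComponent a d i x * x.2 i := h2
  unfold branchSign
  refine ⟨?_, ?_, ?_⟩
  · rw [div_pow, hsq, hs, div_self hα.ne']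
  · rw [h1']
    field_simp
    rw [hs, ← hsq]
  · rw [h2']
    field_simp
    rw [hs, ← hsq]

theorem branchSign_mem (hu : ∀ i, x.1 i ^ 2 + x.2 i ^ 2 = 1) {i : Fin 3}
    (h : a * x.2 i + d * (x.1 0 * x.2 i - x.1 i * x.2 0) = 0)
    (hα : 0 < phasorNormSq a d (x.1 0)) : branchSign a d i x ∈ ({1, -1} : Finset ℝ) := by
  have := sq_eq_one_iff.1 (branchSign_spec hu h hα).1
  simpa using this

end Reduced

/-- An angle of a planar unit vector. -/
noncomputable def planeAngle (u v : ℝ) : ℝ := Complex.arg ⟨u, v⟩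

theorem cos_sin_planeAngle {u v : ℝ} (h : u ^ 2 + v ^ 2 = 1) :
    Real.cos (planeAngle u v) = u ∧ Real.sin (planeAngle u v) = v := by
  obtain ⟨t, rfl, rfl⟩ := exists_cos_sin h
  have h1 : (⟨Real.cos t, Real.sin t⟩ : ℂ) = Complex.exp (t * Complex.I) := by
    rw [Complex.exp_mul_I]
    apply Complex.ext <;> simp [Complex.cos_ofReal_re, Complex.sin_ofReal_re]
  have hn : ‖(⟨Real.cos t, Real.sin t⟩ : ℂ)‖ = 1 := by
    rw [h1, Complex.norm_exp_ofReal_mul_I]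
  have h0 : (⟨Real.cos t, Real.sin t⟩ : ℂ) ≠ 0 := by
    intro h0
    simp [h0] at hn
  unfold planeAngle
  constructor
  · rw [Complex.cos_arg h0, hn, div_one]
  · rw [Complex.sin_arg, hn, div_one]

/-- The number of solutions of nearby systems that a solution of the reduced system accounts for. -/
noncomputable def solutionWeight (c a d f g : ℝ) (x : VoltageState) : ℕ∞ :=
  if phasorNormSq a d (x.1 0) = 0 ∨ phasorNormSq f g (x.1 0) = 0 then 1 else
    analyticOrderAt (branchBalance c a d f g (branchSign a d 1 x) (branchSign f g 2 x))
      (planeAngle (x.1 0) (x.2 0))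

section Reduced

variable {c a d f g : ℝ} {x : VoltageState}

theorem branchBalance_eq_zero (hx : x ∈ reducedSolutions c a d f g)
    (hα : 0 < phasorNormSq a d (x.1 0)) (hβ : 0 < phasorNormSq f g (x.1 0)) :
    x.2 0 * (c + branchSign a d 1 x * (a * d) / √(phasorNormSq a d (x.1 0)) +
      branchSign f g 2 x * (f * g) / √(phasorNormSq f g (x.1 0))) = 0 := by
  obtain ⟨h0, h1, h2, hu⟩ := hx
  obtain ⟨-, hw, hw'⟩ := branchSign_spec hu h1 hα
  obtain ⟨-, hx, hx'⟩ := branchSign_spec hu h2 hβ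
  rw [hw, hw', hx, hx'] at h0
  rw [← h0]
  ring

theorem one_le_solutionWeight (hx : x ∈ reducedSolutions c a d f g) :
    1 ≤ solutionWeight c a d f g x := by
  unfold solutionWeight
  split_ifs with h
  · exact le_rfl
  · push Not at h
    have hu := hx.2.2.2
    have hα := (phasorNormSq_nonneg hu a d).lt_of_ne' h.1
    have hβ := (phasorNormSq_nonneg hu f g).lt_of_ne' h.2
    obtain ⟨hc, hs⟩ := cos_sin_planeAngle (hu 0)
    rw [Order.one_le_iff_ne_zero]
    refine (analyticAt_branchBalance (by rwa [hc]) (by rwa [hc])).analyticOrderAt_ne_zero.2 ?_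
    unfold branchBalance
    rw [hc, hs]
    exact branchBalance_eq_zero hx hα hβ

/-- Where the phasor `a + d z₁` vanishes, the phases are all `0` or `π`, unless the other phasor
vanishes as well. -/
theorem sin_eq_zero_of_phasor_eq_zero (hx : x ∈ reducedSolutions c a d f g)
    (had : a ≠ 0 ∨ d ≠ 0) (hα : phasorNormSq a d (x.1 0) = 0)
    (hβ : phasorNormSq f g (x.1 0) ≠ 0) : x.2 0 = 0 ∧ x.2 1 = 0 ∧ x.2 2 = 0 := by
  obtain ⟨h0, h1, h2, hu⟩ := hx
  obtain ⟨-, hd, hS⟩ := phasor_eq_zero hu had hα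
  -- The phasor of bus 3 is real and nonzero here, and the voltage of bus 3 is parallel to it.
  have h3 : x.2 2 = 0 := by
    obtain ⟨-, hr⟩ := phasor_parallel hu h2
    rw [hS, mul_zero] at hr
    refine (mul_eq_zero.1 hr.symm).resolve_left fun hr0 => hβ ?_
    rw [← phasorComponent_sq hu h2]
    simp only [phasorComponent, hS, hr0]
    norm_num
  refine ⟨hS, ?_, h3⟩
  have hC : x.1 0 ≠ 0 := by
    intro hC
    have := hu 0
    rw [hC, hS] at this
    norm_num at this
  rw [hS, h3] at h0
  -- The balance at bus 2 is void here; bus 1 is what fixes the voltage of bus 2.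
  have h4 : d * x.1 0 * x.2 1 = 0 := by linarith
  exact (mul_eq_zero.1 h4).resolve_left (mul_ne_zero hd hC)

theorem sin_eq_zero_of_phasor_eq_zero' (hx : x ∈ reducedSolutions c a d f g)
    (hfg : f ≠ 0 ∨ g ≠ 0) (hβ : phasorNormSq f g (x.1 0) = 0)
    (hα : phasorNormSq a d (x.1 0) ≠ 0) : x.2 0 = 0 ∧ x.2 1 = 0 ∧ x.2 2 = 0 := by
  obtain ⟨h0, h1, h2, hu⟩ := hx
  obtain ⟨-, hg, hS⟩ := phasor_eq_zero hu hfg hβ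
  have h3 : x.2 1 = 0 := by
    obtain ⟨-, hr⟩ := phasor_parallel hu h1
    rw [hS, mul_zero] at hr
    refine (mul_eq_zero.1 hr.symm).resolve_left fun hr0 => hα ?_
    rw [← phasorComponent_sq hu h1]
    simp only [phasorComponent, hS, hr0]
    norm_num
  refine ⟨hS, h3, ?_⟩
  have hC : x.1 0 ≠ 0 := by
    intro hC
    have := hu 0
    rw [hC, hS] at this
    norm_num at this
  rw [hS, h3] at h0
  have h4 : g * x.1 0 * x.2 2 = 0 := by linarith
  exact (mul_eq_zero.1 h4).resolve_left (mul_ne_zero hg hC)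

/-- If the first phasor vanishes then `r = 0`, and the determinant reduces to `-D ^ 2 * r'`. Here
`D` is `d` times a product of real unit voltages and `r'` is plus or minus the length of the other
phasor, both nonzero. The other case is symmetric. -/
theorem jacobianDet_ne_zero (hx : x ∈ reducedSolutions c a d f g)
    (had : a ≠ 0 ∨ d ≠ 0) (hfg : f ≠ 0 ∨ g ≠ 0)
    (h : phasorNormSq a d (x.1 0) = 0 ∨ phasorNormSq f g (x.1 0) = 0)
    (h' : ¬ (phasorNormSq a d (x.1 0) = 0 ∧ phasorNormSq f g (x.1 0) = 0)) :
    jacobianDet c a d f g x ≠ 0 := by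
  obtain ⟨h0, h1, h2, hu⟩ := id hx
  have hα := phasorComponent_sq hu h1
  have hβ := phasorComponent_sq hu h2
  set r := phasorComponent a d 1 x
  set r' := phasorComponent f g 2 x
  have hJ : jacobianDet c a d f g x =
      (c * x.1 0 + d * (x.1 0 * x.1 1 + x.2 0 * x.2 1) + g * (x.1 0 * x.1 2 + x.2 0 * x.2 2)) *
        r * r' - (d * (x.1 0 * x.1 1 + x.2 0 * x.2 1)) ^ 2 * r' -
        (g * (x.1 0 * x.1 2 + x.2 0 * x.2 2)) ^ 2 * r := rfl
  clear_value r r'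
  have hunit : ∀ i, x.2 i = 0 → x.1 i ≠ 0 := by
    intro i hi h0
    have := hu i
    rw [hi, h0] at this
    norm_num at this
  rcases h with hz | hz
  · have hnz : phasorNormSq f g (x.1 0) ≠ 0 := fun hz' => h' ⟨hz, hz'⟩
    obtain ⟨s0, s1, s2⟩ := sin_eq_zero_of_phasor_eq_zero hx had hz hnz
    have hd := (phasor_eq_zero hu had hz).2.1
    have hr0 : r = 0 := by
      rw [hz] at hα
      exact pow_eq_zero_iff two_ne_zero |>.1 hα
    have hr'0 : r' ≠ 0 := by
      intro h
      rw [h] at hβ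
      exact hnz (by rw [← hβ]; norm_num)
    rw [hJ, hr0, s0, s1]
    have := hunit 0 s0
    have := hunit 1 s1
    simp [*]
  · have hnz : phasorNormSq a d (x.1 0) ≠ 0 := fun hz' => h' ⟨hz', hz⟩
    obtain ⟨s0, s1, s2⟩ := sin_eq_zero_of_phasor_eq_zero' hx hfg hz hnz
    have hg := (phasor_eq_zero hu hfg hz).2.1
    have hr0 : r' = 0 := by
      rw [hz] at hβ
      exact pow_eq_zero_iff two_ne_zero |>.1 hβ
    have hr'0 : r ≠ 0 := by
      intro h
      rw [h] at hα
      exact hnz (by rw [← hα]; norm_num)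
    rw [hJ, hr0, s0, s2]
    have := hunit 0 s0
    have := hunit 2 s2
    simp [*]

/-! ### Adding up the weights to sixteen -/

/-- The number of solutions that a voltage `v` of bus `1` accounts for. -/
noncomputable def fiberWeight (c a d f g : ℝ) (v : ℝ × ℝ) : ℕ :=
  4 * (if v.2 = 0 then 1 else 0) +
    (signProduct c a d f g).rootMultiplicity v.1 * ((if v.2 = 0 then 1 else 0) + 1)

/-- If one phasor vanishes, the voltages of buses 2 and 3 are `±1`: at most four solutions of weight
one, covered by the four units that `fiberWeight` reserves at real `v`. If neither vanishes, the two
branch signs determine the solution over `v`, and the weights are among the orders summed in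
`sum_analyticOrderAt_branchBalance`. -/
theorem sum_solutionWeight_fiber_le (had : a ≠ 0 ∨ d ≠ 0) (hfg : f ≠ 0 ∨ g ≠ 0)
    (hQ : signProduct c a d f g ≠ 0) {v : ℝ × ℝ} {T : Finset VoltageState}
    (hT : ∀ x ∈ T, x ∈ reducedSolutions c a d f g) (hv : ∀ x ∈ T, (x.1 0, x.2 0) = v)
    (hreg : ¬ (phasorNormSq a d v.1 = 0 ∧ phasorNormSq f g v.1 = 0)) :
    ∑ x ∈ T, solutionWeight c a d f g x ≤ fiberWeight c a d f g v := by
  rcases T.eq_empty_or_nonempty with rfl | ⟨x₀, hx₀⟩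
  · simp
  have hv1 : ∀ x ∈ T, x.1 0 = v.1 := fun x hx => congrArg Prod.fst (hv x hx)
  have hv2 : ∀ x ∈ T, x.2 0 = v.2 := fun x hx => congrArg Prod.snd (hv x hx)
  have hvu : v.1 ^ 2 + v.2 ^ 2 = 1 := by
    rw [← hv1 x₀ hx₀, ← hv2 x₀ hx₀]
    exact (hT x₀ hx₀).2.2.2 0
  by_cases hz : phasorNormSq a d v.1 = 0 ∨ phasorNormSq f g v.1 = 0
  · have hsin : ∀ x ∈ T, x.2 0 = 0 ∧ x.2 1 = 0 ∧ x.2 2 = 0 := by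
      intro x hx
      rw [← hv1 x hx] at hz hreg
      rcases hz with hz | hz
      · exact sin_eq_zero_of_phasor_eq_zero (hT x hx) had hz fun h => hreg ⟨hz, h⟩
      · exact sin_eq_zero_of_phasor_eq_zero' (hT x hx) hfg hz fun h => hreg ⟨h, hz⟩
    have hw : ∀ x ∈ T, solutionWeight c a d f g x = 1 := by
      intro x hx
      rw [solutionWeight, hv1 x hx, if_pos hz]
    have hcard : T.card ≤ (({1, -1} : Finset ℝ) ×ˢ ({1, -1} : Finset ℝ)).card := by
      refine Finset.card_le_card_of_injOn (fun x => (x.1 1, x.1 2)) ?_ ?_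
      · intro x hx
        obtain ⟨-, s1, s2⟩ := hsin x hx
        have hu := (hT x hx).2.2.2
        have u1 := hu 1
        have u2 := hu 2
        rw [s1] at u1
        rw [s2] at u2
        simpa using And.intro (sq_eq_one_iff.1 (show x.1 1 ^ 2 = 1 by linarith))
          (sq_eq_one_iff.1 (show x.1 2 ^ 2 = 1 by linarith))
      · intro x hx y hy hxy
        obtain ⟨s0, s1, s2⟩ := hsin x hx
        obtain ⟨s0', s1', s2'⟩ := hsin y hy
        simp only [Prod.mk.injEq] at hxy
        refine Prod.ext (funext fun i => ?_) (funext fun i => ?_) <;> fin_cases i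
        · exact (hv1 x hx).trans (hv1 y hy).symm
        · exact hxy.1
        · exact hxy.2
        · exact s0.trans s0'.symm
        · exact s1.trans s1'.symm
        · exact s2.trans s2'.symm
    have hv0 : v.2 = 0 := (hv2 x₀ hx₀).symm.trans (hsin x₀ hx₀).1
    have hne : (1 : ℝ) ≠ -1 := by norm_num
    rw [Finset.card_product, Finset.card_pair hne] at hcard
    rw [Finset.sum_congr rfl hw, Finset.sum_const, nsmul_eq_mul, mul_one]
    refine Nat.cast_le.2 (hcard.trans ?_)
    simp [fiberWeight, hv0]
  · have hz' := hz
    push Not at hz'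
    have hα : 0 < phasorNormSq a d v.1 := by
      rw [← hv1 x₀ hx₀] at hz' ⊢
      exact (phasorNormSq_nonneg (hT x₀ hx₀).2.2.2 a d).lt_of_ne' hz'.1
    have hβ : 0 < phasorNormSq f g v.1 := by
      rw [← hv1 x₀ hx₀] at hz' ⊢
      exact (phasorNormSq_nonneg (hT x₀ hx₀).2.2.2 f g).lt_of_ne' hz'.2
    obtain ⟨hcos, hsin⟩ := cos_sin_planeAngle hvu
    have hw : ∀ x ∈ T, solutionWeight c a d f g x = (fun s : ℝ × ℝ =>
        analyticOrderAt (branchBalance c a d f g s.1 s.2) (planeAngle v.1 v.2))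
        (branchSign a d 1 x, branchSign f g 2 x) := by
      intro x hx
      rw [solutionWeight, hv1 x hx, if_neg hz, hv2 x hx]
    have hinj : Set.InjOn (fun x => (branchSign a d 1 x, branchSign f g 2 x)) (T : Set VoltageState) := by
      intro x hx y hy hxy
      simp only [Prod.mk.injEq] at hxy
      obtain ⟨-, e1, e2, ux⟩ := hT x hx
      obtain ⟨-, e1', e2', uy⟩ := hT y hy
      obtain ⟨-, w1, w2⟩ := branchSign_spec ux e1 (by rwa [hv1 x hx])
      obtain ⟨-, w3, w4⟩ := branchSign_spec ux e2 (by rwa [hv1 x hx])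
      obtain ⟨-, w1', w2'⟩ := branchSign_spec uy e1' (by rwa [hv1 y hy])
      obtain ⟨-, w3', w4'⟩ := branchSign_spec uy e2' (by rwa [hv1 y hy])
      rw [hv1 x hx, hxy.1] at w1
      rw [hv1 x hx, hv2 x hx, hxy.1] at w2
      rw [hv1 x hx, hxy.2] at w3
      rw [hv1 x hx, hv2 x hx, hxy.2] at w4
      rw [hv1 y hy] at w1' w3'
      rw [hv1 y hy, hv2 y hy] at w2' w4'
      refine Prod.ext (funext fun i => ?_) (funext fun i => ?_) <;> fin_cases i
      · exact (hv1 x hx).trans (hv1 y hy).symm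
      · exact w1.trans w1'.symm
      · exact w3.trans w3'.symm
      · exact (hv2 x hx).trans (hv2 y hy).symm
      · exact w2.trans w2'.symm
      · exact w4.trans w4'.symm
    have hsum := sum_analyticOrderAt_branchBalance (c := c) (a := a) (d := d) (f := f) (g := g)
      (t := planeAngle v.1 v.2) (by rwa [hcos]) (by rwa [hcos]) hQ
    rw [hcos, hsin] at hsum
    calc ∑ x ∈ T, solutionWeight c a d f g x
        = ∑ s ∈ T.image fun x => (branchSign a d 1 x, branchSign f g 2 x),
          analyticOrderAt (branchBalance c a d f g s.1 s.2) (planeAngle v.1 v.2) := by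
          rw [Finset.sum_image hinj]
          exact Finset.sum_congr rfl hw
      _ ≤ ∑ s ∈ ({1, -1} : Finset ℝ) ×ˢ ({1, -1} : Finset ℝ),
          analyticOrderAt (branchBalance c a d f g s.1 s.2) (planeAngle v.1 v.2) := by
          refine Finset.sum_le_sum_of_subset fun s hs => ?_
          obtain ⟨x, hx, rfl⟩ := Finset.mem_image.1 hs
          obtain ⟨-, e1, e2, ux⟩ := hT x hx
          exact Finset.mem_product.2 ⟨branchSign_mem ux e1 (by rwa [hv1 x hx]),
            branchSign_mem ux e2 (by rwa [hv1 x hx])⟩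
      _ = fiberWeight c a d f g v := by
          rw [hsum, fiberWeight]
          split_ifs <;> push_cast <;> rfl

/-- The first summand counts 4 at each of the real voltages `±1`. In the second, the points over a
given real part contribute at most twice its root multiplicity, and `signProduct` has at most four
roots. -/
theorem sum_fiberWeight_le (V : Finset (ℝ × ℝ))
    (hV : ∀ v ∈ V, v.1 ^ 2 + v.2 ^ 2 = 1) : ∑ v ∈ V, fiberWeight c a d f g v ≤ 16 := by
  have h1 : ∑ v ∈ V, 4 * (if v.2 = 0 then 1 else 0) ≤ 8 := by
    rw [← Finset.mul_sum, Finset.sum_boole]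
    have : (V.filter fun v => v.2 = 0).card ≤ (({1, -1} : Finset ℝ)).card := by
      refine Finset.card_le_card_of_injOn Prod.fst ?_ ?_
      · intro v hv
        have hv' := Finset.mem_filter.1 hv
        have := hV v hv'.1
        rw [hv'.2] at this
        simpa using sq_eq_one_iff.1 (show v.1 ^ 2 = 1 by linarith)
      · intro v hv w hw h
        exact Prod.ext h ((Finset.mem_filter.1 hv).2.trans (Finset.mem_filter.1 hw).2.symm)
    rw [Finset.card_pair (by norm_num)] at this
    simp only [Nat.cast_id]
    omega
  have h2 : ∑ v ∈ V, (signProduct c a d f g).rootMultiplicity v.1 *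
      ((if v.2 = 0 then 1 else 0) + 1) ≤ 8 := by
    rw [← Finset.sum_fiberwise_of_maps_to (g := Prod.fst) (t := V.image Prod.fst)
      fun v hv => Finset.mem_image_of_mem _ hv]
    have hfib : ∀ y, ∑ v ∈ V with v.1 = y, ((if v.2 = 0 then 1 else 0) + 1) ≤ 2 := by
      intro y
      by_cases hy : 1 - y ^ 2 = 0
      · have hsub : (V.filter fun v => v.1 = y) ⊆ {(y, 0)} := by
          intro v hv
          obtain ⟨hvV, rfl⟩ := Finset.mem_filter.1 hv
          have := hV v hvV
          have : v.2 = 0 := pow_eq_zero_iff two_ne_zero |>.1 (by linarith)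
          rw [Finset.mem_singleton]
          exact Prod.ext rfl this
        refine (Finset.sum_le_sum_of_subset hsub).trans ?_
        simp
      · have hsub : (V.filter fun v => v.1 = y) ⊆ {(y, √(1 - y ^ 2)), (y, -√(1 - y ^ 2))} := by
          intro v hv
          obtain ⟨hvV, rfl⟩ := Finset.mem_filter.1 hv
          have h3 : v.2 ^ 2 = 1 - v.1 ^ 2 := by linarith [hV v hvV]
          have h4 : √(1 - v.1 ^ 2) = |v.2| := by rw [← h3, Real.sqrt_sq_eq_abs]
          rw [Finset.mem_insert, Finset.mem_singleton, h4]
          rcases abs_choice v.2 with h | h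
          · exact Or.inl (Prod.ext rfl h.symm)
          · exact Or.inr (Prod.ext rfl (by rw [h, neg_neg]))
        have hne : ∀ v ∈ V.filter (fun v => v.1 = y),
            (if v.2 = 0 then 1 else 0) + 1 = 1 := by
          intro v hv
          obtain ⟨hvV, rfl⟩ := Finset.mem_filter.1 hv
          rw [if_neg, zero_add]
          intro h0
          exact hy (by have := hV v hvV; rw [h0] at this; linarith)
        rw [Finset.sum_congr rfl hne, Finset.sum_const, smul_eq_mul, mul_one]
        exact (Finset.card_le_card hsub).trans Finset.card_le_two
    have hstep : ∀ y ∈ V.image Prod.fst, ∑ v ∈ V with v.1 = y,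
        (signProduct c a d f g).rootMultiplicity v.1 * ((if v.2 = 0 then 1 else 0) + 1) ≤
        2 * (signProduct c a d f g).roots.count y := by
      intro y _
      have : ∑ v ∈ V with v.1 = y,
        (signProduct c a d f g).rootMultiplicity v.1 * ((if v.2 = 0 then 1 else 0) + 1) =
        ∑ v ∈ V with v.1 = y,
        (signProduct c a d f g).rootMultiplicity y * ((if v.2 = 0 then 1 else 0) + 1) :=
        Finset.sum_congr rfl fun v hv => by rw [(Finset.mem_filter.1 hv).2]
      rw [this, ← Finset.mul_sum, Polynomial.count_roots, mul_comm]
      exact Nat.mul_le_mul_right _ (hfib y)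
    refine (Finset.sum_le_sum hstep).trans ?_
    rw [← Finset.mul_sum]
    have h3 : ∑ y ∈ V.image Prod.fst, (signProduct c a d f g).roots.count y ≤
        Multiset.card (signProduct c a d f g).roots := by
      classical
      rw [← Multiset.toFinset_sum_count_eq]
      refine Finset.sum_le_sum_of_ne_zero fun y _ hy => ?_
      rw [Multiset.mem_toFinset]
      exact Multiset.count_ne_zero.1 hy
    have h4 := (Polynomial.card_roots' (signProduct c a d f g)).trans
      (natDegree_signProduct_le c a d f g)
    omega
  unfold fiberWeight
  rw [Finset.sum_add_distrib]
  omega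

theorem sum_solutionWeight_le (had : a ≠ 0 ∨ d ≠ 0) (hfg : f ≠ 0 ∨ g ≠ 0)
    (hQ : signProduct c a d f g ≠ 0) {T : Finset VoltageState}
    (hT : ∀ x ∈ T, x ∈ reducedSolutions c a d f g)
    (hreg : ∀ x ∈ T, ¬ (phasorNormSq a d (x.1 0) = 0 ∧ phasorNormSq f g (x.1 0) = 0)) :
    ∑ x ∈ T, solutionWeight c a d f g x ≤ 16 := by
  set v : VoltageState → ℝ × ℝ := fun x => (x.1 0, x.2 0) with hv
  rw [← Finset.sum_fiberwise_of_maps_to (g := v) (t := T.image v)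
    fun x hx => Finset.mem_image_of_mem _ hx]
  have hle : ∀ w ∈ T.image v, ∑ x ∈ T with v x = w, solutionWeight c a d f g x ≤
      (fiberWeight c a d f g w : ℕ∞) := by
    intro w hw
    obtain ⟨x, hx, rfl⟩ := Finset.mem_image.1 hw
    exact sum_solutionWeight_fiber_le had hfg hQ (fun y hy => hT y (Finset.mem_filter.1 hy).1)
      (fun y hy => (Finset.mem_filter.1 hy).2) (hreg x hx)
  refine (Finset.sum_le_sum hle).trans ?_
  rw [← Nat.cast_sum]
  have := sum_fiberWeight_le (c := c) (a := a) (d := d) (f := f) (g := g) (T.image v) (fun w hw => by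
    obtain ⟨x, hx, rfl⟩ := Finset.mem_image.1 hw
    exact (hT x hx).2.2.2 0)
  exact_mod_cast this

end Reduced

/-! ### Curves of solutions through non-isolated points -/

section Isolated

theorem notMem_isolatedPoints_of_curve {X : Type*} [TopologicalSpace X] {S : Set X} {x : X}
    (γ : ℝ → X) (hγ : ContinuousAt γ 0) (h0 : γ 0 = x) (hS : ∀ᶠ t in 𝓝 0, γ t ∈ S)
    (hne : ∀ᶠ t in 𝓝[≠] (0 : ℝ), γ t ≠ x) : x ∉ isolatedPoints S := by
  rintro ⟨hx, U, hU, hUS⟩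
  have hxU : x ∈ U := (hUS.symm ▸ mem_singleton x : x ∈ U ∩ S).1
  have h1 : ∀ᶠ t in 𝓝 0, γ t ∈ U := hγ.eventually_mem (by rw [h0]; exact hU.mem_nhds hxU)
  have h2 : ∀ᶠ t in 𝓝[≠] (0 : ℝ), False := by
    filter_upwards [hne, h1.filter_mono nhdsWithin_le_nhds,
      hS.filter_mono nhdsWithin_le_nhds] with t h3 h4 h5
    exact h3 (hUS ▸ (⟨h4, h5⟩ : γ t ∈ U ∩ S) : γ t ∈ ({x} : Set X))
  exact (h2.exists).elim fun _ h => h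

theorem Set.Finite.mem_isolatedPoints {X : Type*} [TopologicalSpace X] [T1Space X] {S : Set X}
    (hS : S.Finite) {x : X} (hx : x ∈ S) : x ∈ isolatedPoints S := by
  refine ⟨hx, (S \ {x})ᶜ, (hS.subset sdiff_subset).isClosed.isOpen_compl, ?_⟩
  ext y
  simp only [mem_inter_iff, mem_compl_iff, mem_sdiff, mem_singleton_iff, not_and, not_not]
  constructor
  · rintro ⟨h1, h2⟩
    exact h1 h2
  · rintro rfl
    exact ⟨fun _ => rfl, hx⟩

theorem eventually_rotation_ne (u : ℝ) : ∀ᶠ t in 𝓝[≠] (0 : ℝ),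
    (Real.cos (u + t), Real.sin (u + t)) ≠ (Real.cos u, Real.sin u) := by
  have h1 : ∀ᶠ t in 𝓝[≠] (0 : ℝ), t ∈ Ioo (-1 : ℝ) 1 :=
    nhdsWithin_le_nhds (Ioo_mem_nhds (by norm_num) (by norm_num))
  filter_upwards [h1, self_mem_nhdsWithin] with t ht ht0 heq
  simp only [Prod.mk.injEq] at heq
  have h2 : Real.cos t = 1 := by
    have : Real.cos t = Real.cos (u + t) * Real.cos u + Real.sin (u + t) * Real.sin u := by
      rw [← Real.cos_sub]
      congr 1
      ring
    rw [this, heq.1, heq.2]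
    linarith [Real.cos_sq_add_sin_sq u]
  have hpi := Real.pi_gt_three
  exact ht0 ((Real.cos_eq_one_iff_of_lt_of_lt (by linarith [ht.1]) (by linarith [ht.2])).1 h2)

/-- The state with given voltages at the PV buses. -/
def vecState (p₀ p₁ p₂ : ℝ × ℝ) : VoltageState := (![p₀.1, p₁.1, p₂.1], ![p₀.2, p₁.2, p₂.2])

theorem vecState_self (x : VoltageState) :
    vecState (x.1 0, x.2 0) (x.1 1, x.2 1) (x.1 2, x.2 2) = x := by
  refine Prod.ext (funext fun i => ?_) (funext fun i => ?_) <;> fin_cases i <;> rfl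

theorem vecState_mem_reducedSolutions {c a d f g : ℝ} {p₀ p₁ p₂ : ℝ × ℝ} :
    vecState p₀ p₁ p₂ ∈ reducedSolutions c a d f g ↔
      c * p₀.2 + d * (p₁.1 * p₀.2 - p₀.1 * p₁.2) + g * (p₂.1 * p₀.2 - p₀.1 * p₂.2) = 0 ∧
      a * p₁.2 + d * (p₀.1 * p₁.2 - p₁.1 * p₀.2) = 0 ∧
      f * p₂.2 + g * (p₀.1 * p₂.2 - p₂.1 * p₀.2) = 0 ∧
      p₀.1 ^ 2 + p₀.2 ^ 2 = 1 ∧ p₁.1 ^ 2 + p₁.2 ^ 2 = 1 ∧ p₂.1 ^ 2 + p₂.2 ^ 2 = 1 := by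
  simp [reducedSolutions, vecState, Fin.forall_fin_succ]

theorem ContinuousAt.vecState {p₀ p₁ p₂ : ℝ → ℝ × ℝ} {t : ℝ} (h₀ : ContinuousAt p₀ t)
    (h₁ : ContinuousAt p₁ t) (h₂ : ContinuousAt p₂ t) :
    ContinuousAt (fun t => vecState (p₀ t) (p₁ t) (p₂ t)) t := by
  refine ContinuousAt.prodMk (continuousAt_pi.2 fun i => ?_) (continuousAt_pi.2 fun i => ?_) <;>
    fin_cases i
  exacts [h₀.fst, h₁.fst, h₂.fst, h₀.snd, h₁.snd, h₂.snd]

/-- The curve `d sin w + g sin u = 0` has no isolated points. -/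
theorem exists_curve_of_abs_le {d g : ℝ} (hd : d ≠ 0) (hgd : |g| ≤ |d|) {p₁ p₂ : ℝ × ℝ}
    (h₁ : p₁.1 ^ 2 + p₁.2 ^ 2 = 1) (h₂ : p₂.1 ^ 2 + p₂.2 ^ 2 = 1) (h : d * p₁.2 + g * p₂.2 = 0) :
    ∃ γ₁ γ₂ : ℝ → ℝ × ℝ, Continuous γ₁ ∧ Continuous γ₂ ∧ γ₁ 0 = p₁ ∧ γ₂ 0 = p₂ ∧
      (∀ t, (γ₁ t).1 ^ 2 + (γ₁ t).2 ^ 2 = 1) ∧ (∀ t, (γ₂ t).1 ^ 2 + (γ₂ t).2 ^ 2 = 1) ∧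
      (∀ t, d * (γ₁ t).2 + g * (γ₂ t).2 = 0) ∧ ∀ᶠ t in 𝓝[≠] (0 : ℝ), γ₂ t ≠ p₂ := by
  obtain ⟨u, hu, hu'⟩ := exists_cos_sin h₂
  obtain ⟨κ, hκ, hκ1⟩ : ∃ κ : ℝ, κ ^ 2 = 1 ∧ κ * |p₁.1| = p₁.1 := by
    rcases le_total 0 p₁.1 with h | h
    · exact ⟨1, by norm_num, by rw [abs_of_nonneg h, one_mul]⟩
    · exact ⟨-1, by norm_num, by rw [abs_of_nonpos h]; ring⟩
  -- By `|g| ≤ |d|` the equation can be solved for the first sine at every `t`; the sign `κ` selects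
  -- the arc that starts at `p₁`.
  have hle : ∀ t, 0 ≤ 1 - (-(g / d) * Real.sin (u + t)) ^ 2 := by
    intro t
    have h1 : (g / d) ^ 2 ≤ 1 := by
      rw [div_pow, div_le_one (by positivity)]
      exact sq_le_sq.2 hgd
    have h2 := Real.sin_sq_le_one (u + t)
    have h3 : (-(g / d) * Real.sin (u + t)) ^ 2 = (g / d) ^ 2 * Real.sin (u + t) ^ 2 := by ring
    nlinarith [sq_nonneg (g / d), sq_nonneg (Real.sin (u + t))]
  have hp₁ : -(g / d) * Real.sin u = p₁.2 := by
    rw [hu']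
    field_simp
    linarith
  refine ⟨fun t => (κ * √(1 - (-(g / d) * Real.sin (u + t)) ^ 2), -(g / d) * Real.sin (u + t)),
    fun t => (Real.cos (u + t), Real.sin (u + t)), by fun_prop, by fun_prop, ?_, ?_, ?_, ?_, ?_, ?_⟩
  · simp only [add_zero, hp₁]
    refine Prod.ext ?_ rfl
    simp only
    rw [show 1 - p₁.2 ^ 2 = p₁.1 ^ 2 by linarith, Real.sqrt_sq_eq_abs, hκ1]
  · simp only [add_zero, hu, hu']
  · intro t
    simp only
    rw [mul_pow, hκ, Real.sq_sqrt (hle t)]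
    ring
  · intro t
    exact Real.cos_sq_add_sin_sq _
  · intro t
    simp only
    field_simp
    ring
  · filter_upwards [eventually_rotation_ne u] with t ht heq
    exact ht (heq.trans (Prod.ext hu.symm hu'.symm))

/-- The sine with the larger coefficient is the one to be solved for. -/
theorem exists_curve {d g : ℝ} (hd : d ≠ 0) (hg : g ≠ 0) {p₁ p₂ : ℝ × ℝ}
    (h₁ : p₁.1 ^ 2 + p₁.2 ^ 2 = 1) (h₂ : p₂.1 ^ 2 + p₂.2 ^ 2 = 1) (h : d * p₁.2 + g * p₂.2 = 0) :
    ∃ γ₁ γ₂ : ℝ → ℝ × ℝ, Continuous γ₁ ∧ Continuous γ₂ ∧ γ₁ 0 = p₁ ∧ γ₂ 0 = p₂ ∧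
      (∀ t, (γ₁ t).1 ^ 2 + (γ₁ t).2 ^ 2 = 1) ∧ (∀ t, (γ₂ t).1 ^ 2 + (γ₂ t).2 ^ 2 = 1) ∧
      (∀ t, d * (γ₁ t).2 + g * (γ₂ t).2 = 0) ∧
      ∀ᶠ t in 𝓝[≠] (0 : ℝ), γ₁ t ≠ p₁ ∨ γ₂ t ≠ p₂ := by
  rcases le_total |g| |d| with hle | hle
  · obtain ⟨γ₁, γ₂, c₁, c₂, e₁, e₂, u₁, u₂, heq, hne⟩ := exists_curve_of_abs_le hd hle h₁ h₂ h
    exact ⟨γ₁, γ₂, c₁, c₂, e₁, e₂, u₁, u₂, heq, hne.mono fun _ => Or.inr⟩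
  · obtain ⟨γ₂, γ₁, c₂, c₁, e₂, e₁, u₂, u₁, heq, hne⟩ :=
      exists_curve_of_abs_le hg hle h₂ h₁ (by linarith)
    exact ⟨γ₁, γ₂, c₁, c₂, e₁, e₂, u₁, u₂, fun t => by linarith [heq t],
      hne.mono fun _ => Or.inl⟩

end Isolated

/-! ### Degenerate networks -/

section Degenerate

variable {c a d f g : ℝ} {x : VoltageState}

/-- With `a = d = 0` bus 2 is disconnected, and its voltage rotates freely. -/
theorem phasor_ne_zero_of_isolated (hx : x ∈ isolatedPoints (reducedSolutions c a d f g)) :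
    a ≠ 0 ∨ d ≠ 0 := by
  by_contra! h
  obtain ⟨rfl, rfl⟩ := h
  obtain ⟨u, hu, hu'⟩ := exists_cos_sin (hx.1.2.2.2 1)
  have hmem := hx.1
  rw [← vecState_self x, vecState_mem_reducedSolutions] at hmem
  obtain ⟨h0, h1, h2, u0, u1, u2⟩ := hmem
  refine notMem_isolatedPoints_of_curve (fun t => vecState (x.1 0, x.2 0)
    (Real.cos (u + t), Real.sin (u + t)) (x.1 2, x.2 2)) ?_ ?_ ?_ ?_ hx
  · exact ContinuousAt.vecState continuousAt_const (by fun_prop) continuousAt_const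
  · simp only [add_zero, hu, hu']
    exact vecState_self x
  · refine Eventually.of_forall fun t => vecState_mem_reducedSolutions.2
      ⟨?_, by ring, h2, u0, Real.cos_sq_add_sin_sq _, u2⟩
    simpa using h0
  · filter_upwards [eventually_rotation_ne u] with t ht heq
    rw [← vecState_self x] at heq
    have e1 := congrFun (congrArg Prod.fst heq) 1
    have e2 := congrFun (congrArg Prod.snd heq) 1
    simp only [vecState, Matrix.cons_val_one, Matrix.cons_val_zero] at e1 e2
    exact ht (Prod.ext (e1.trans hu.symm) (e2.trans hu'.symm))

theorem phasor_ne_zero_of_isolated' (hx : x ∈ isolatedPoints (reducedSolutions c a d f g)) :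
    f ≠ 0 ∨ g ≠ 0 := by
  by_contra! h
  obtain ⟨rfl, rfl⟩ := h
  obtain ⟨u, hu, hu'⟩ := exists_cos_sin (hx.1.2.2.2 2)
  have hmem := hx.1
  rw [← vecState_self x, vecState_mem_reducedSolutions] at hmem
  obtain ⟨h0, h1, h2, u0, u1, u2⟩ := hmem
  refine notMem_isolatedPoints_of_curve (fun t => vecState (x.1 0, x.2 0) (x.1 1, x.2 1)
    (Real.cos (u + t), Real.sin (u + t))) ?_ ?_ ?_ ?_ hx
  · exact ContinuousAt.vecState continuousAt_const continuousAt_const (by fun_prop)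
  · simp only [add_zero, hu, hu']
    exact vecState_self x
  · refine Eventually.of_forall fun t => vecState_mem_reducedSolutions.2
      ⟨?_, h1, by ring, u0, u1, Real.cos_sq_add_sin_sq _⟩
    simpa using h0
  · filter_upwards [eventually_rotation_ne u] with t ht heq
    rw [← vecState_self x] at heq
    have e1 := congrFun (congrArg Prod.fst heq) 2
    have e2 := congrFun (congrArg Prod.snd heq) 2
    simp only [vecState, Matrix.cons_val] at e1 e2
    exact ht (Prod.ext (e1.trans hu.symm) (e2.trans hu'.symm))

/-- When both phasors vanish, the balances at buses 2 and 3 hold for all voltages there. What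
remains is the single equation `d sin w + g sin u = 0` for two angles, whose solutions form curves.
-/
theorem not_both_phasors_zero_of_isolated
    (hx : x ∈ isolatedPoints (reducedSolutions c a d f g)) :
    ¬ (phasorNormSq a d (x.1 0) = 0 ∧ phasorNormSq f g (x.1 0) = 0) := by
  rintro ⟨hα, hβ⟩
  have hu := hx.1.2.2.2
  obtain ⟨ha, hd, hS⟩ := phasor_eq_zero hu (phasor_ne_zero_of_isolated hx) hα
  obtain ⟨hf, hg, -⟩ := phasor_eq_zero hu (phasor_ne_zero_of_isolated' hx) hβ
  have hC : x.1 0 ≠ 0 := by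
    intro h
    have := hu 0
    rw [hS, h] at this
    norm_num at this
  have h0 := hx.1.1
  rw [hS] at h0
  have hcurve : d * x.2 1 + g * x.2 2 = 0 := by
    have : x.1 0 * (d * x.2 1 + g * x.2 2) = 0 := by linarith
    exact (mul_eq_zero.1 this).resolve_left hC
  obtain ⟨γ₁, γ₂, c₁, c₂, e₁, e₂, u₁, u₂, heq, hne⟩ :=
    exists_curve (p₁ := (x.1 1, x.2 1)) (p₂ := (x.1 2, x.2 2)) hd hg (hu 1) (hu 2) hcurve
  refine notMem_isolatedPoints_of_curve (fun t => vecState (x.1 0, x.2 0) (γ₁ t) (γ₂ t))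
    ?_ ?_ ?_ ?_ hx
  · exact ContinuousAt.vecState continuousAt_const c₁.continuousAt c₂.continuousAt
  · simp only [e₁, e₂]
    exact vecState_self x
  · refine Eventually.of_forall fun t => vecState_mem_reducedSolutions.2
      ⟨?_, ?_, ?_, hu 0, u₁ t, u₂ t⟩
    · simp only [hS]
      linear_combination (-x.1 0) * heq t
    · simp only [hS]
      linear_combination (γ₁ t).2 * ha
    · simp only [hS]
      linear_combination (γ₂ t).2 * hf
  · filter_upwards [hne] with t ht hxt
    rw [← vecState_self x] at hxt
    have e1 := congrFun (congrArg Prod.fst hxt) 1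
    have e2 := congrFun (congrArg Prod.snd hxt) 1
    have e3 := congrFun (congrArg Prod.fst hxt) 2
    have e4 := congrFun (congrArg Prod.snd hxt) 2
    simp only [vecState, Matrix.cons_val, Matrix.cons_val_one, Matrix.cons_val_zero] at e1 e2 e3 e4
    exact ht.elim (fun h => h (Prod.ext e1 e2)) (fun h => h (Prod.ext e3 e4))

theorem signProduct_eq_zero_leading (hQ : signProduct c a d f g = 0) :
    c = 0 ∨ a * d = 0 ∨ f * g = 0 := by
  have h : ∀ y, (signProduct c a d f g).eval y = 0 := fun y => by rw [hQ, Polynomial.eval_zero]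
  simp only [eval_signProduct, phasorNormSq] at h
  have h4 : c ^ 4 * (a * d) ^ 2 * (f * g) ^ 2 = 0 := by
    -- The fourth difference of a quartic is 24 times its leading coefficient, here `16 c⁴ (ad)²
    -- (fg)²`; and `24 · 16 = 384`.
    linear_combination (1 / 384) * (h (-2) - 4 * h (-1) + 6 * h 0 - 4 * h 1 + h 2)
  simpa [or_assoc] using h4

/-- If the product over the signs vanishes identically, then one of its factors does. -/
theorem signProduct_eq_zero (had : a ≠ 0 ∨ d ≠ 0) (hfg : f ≠ 0 ∨ g ≠ 0)
    (hQ : signProduct c a d f g = 0) : c = 0 ∧ ((a * d = 0 ∧ f * g = 0) ∨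
      (a * d = f * g ∧ a * d ≠ 0 ∧ ∀ y, phasorNormSq a d y = phasorNormSq f g y)) := by
  have h : ∀ y, (signProduct c a d f g).eval y = 0 := fun y => by rw [hQ, Polynomial.eval_zero]
  simp only [eval_signProduct, phasorNormSq] at h
  have hlead := signProduct_eq_zero_leading hQ
  have hpos : ∀ {a d : ℝ}, (a ≠ 0 ∨ d ≠ 0) → a ^ 2 + d ^ 2 ≠ 0 := by
    intro a d had h0
    have h1 : a ^ 2 = 0 := by nlinarith [sq_nonneg a, sq_nonneg d]
    have h2 : d ^ 2 = 0 := by nlinarith [sq_nonneg a, sq_nonneg d]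
    exact had.elim (fun h => h (by simpa using h1)) (fun h => h (by simpa using h2))
  have ha1 := hpos had
  have hb1 := hpos hfg
  set p := a * d
  set q := f * g
  set a1 := a ^ 2 + d ^ 2
  set b1 := f ^ 2 + g ^ 2
  -- If one of `p`, `q` is zero, the product over the signs is the square of such an affine function
  -- of `y`, which cannot vanish identically when `c ≠ 0`.
  have hstep : ∀ {c q a1 b1 : ℝ}, a1 ≠ 0 → b1 ≠ 0 → c ≠ 0 → (∀ y, a1 * (c ^ 2 * (b1 + 2 * q * y) - q ^ 2) = 0) →
      False := by
    intro c q a1 b1 ha hb hc h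
    have h0 := (mul_eq_zero.1 (h 0)).resolve_left ha
    have h1 := (mul_eq_zero.1 (h 1)).resolve_left ha
    have h2 : c ^ 2 * q = 0 := by linarith
    have h3 : q = 0 := (mul_eq_zero.1 h2).resolve_left (pow_ne_zero 2 hc)
    rw [h3] at h0
    have h4 : c ^ 2 * b1 = 0 := by linarith
    exact hb ((mul_eq_zero.1 h4).resolve_left (pow_ne_zero 2 hc))
  by_cases hc : c = 0
  · refine ⟨hc, ?_⟩
    -- For `c = 0` the quartic is the square of this affine function; its slope gives `p q (p - q) =
    -- 0`.
    have h' : ∀ y, p ^ 2 * (b1 + 2 * q * y) - q ^ 2 * (a1 + 2 * p * y) = 0 := by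
      intro y
      have := h y
      rw [hc] at this
      exact pow_eq_zero_iff two_ne_zero |>.1 (by linear_combination this)
    have e0 := h' 0
    have e1 := h' 1
    have hpq : p * q * (p - q) = 0 := by linarith
    by_cases hp : p = 0
    · left
      refine ⟨hp, ?_⟩
      rw [hp] at e0
      have : q ^ 2 * a1 = 0 := by linarith
      exact pow_eq_zero_iff two_ne_zero |>.1 ((mul_eq_zero.1 this).resolve_right ha1)
    · by_cases hq : q = 0
      · left
        rw [hq] at e0
        have : p ^ 2 * b1 = 0 := by linarith
        exact ⟨pow_eq_zero_iff two_ne_zero |>.1 ((mul_eq_zero.1 this).resolve_right hb1), hq⟩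
      · right
        have hpq' : p = q := by
          have := (mul_eq_zero.1 hpq).resolve_left (mul_ne_zero hp hq)
          linarith
        refine ⟨hpq', hp, fun y => ?_⟩
        rw [← hpq'] at e0
        have h5 : p ^ 2 * (b1 - a1) = 0 := by linarith
        have h6 := (mul_eq_zero.1 h5).resolve_left (pow_ne_zero 2 hp)
        change a1 + 2 * p * y = b1 + 2 * q * y
        rw [← hpq']
        linarith
  · exfalso
    rcases hlead.resolve_left hc with hp | hq
    · refine hstep (q := q) ha1 hb1 hc fun y => ?_
      have := h y
      rw [hp] at this
      exact pow_eq_zero_iff two_ne_zero |>.1 (by linear_combination this)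
    · refine hstep (q := p) hb1 ha1 hc fun y => ?_
      have := h y
      rw [hq] at this
      exact pow_eq_zero_iff two_ne_zero |>.1 (by linear_combination this)

/-- The state on the branch `(s, s')` with phase angle `φ` at bus `1`. -/
noncomputable def branchState (a d f g s s' φ : ℝ) : VoltageState :=
  vecState (Real.cos φ, Real.sin φ)
    (s * (a + d * Real.cos φ) / √(phasorNormSq a d (Real.cos φ)),
      s * (d * Real.sin φ) / √(phasorNormSq a d (Real.cos φ)))
    (s' * (f + g * Real.cos φ) / √(phasorNormSq f g (Real.cos φ)),
      s' * (g * Real.sin φ) / √(phasorNormSq f g (Real.cos φ)))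

theorem branchState_mem {s s' φ : ℝ} (hs : s ^ 2 = 1) (hs' : s' ^ 2 = 1)
    (hα : 0 < phasorNormSq a d (Real.cos φ)) (hβ : 0 < phasorNormSq f g (Real.cos φ))
    (h : c + s * (a * d) / √(phasorNormSq a d (Real.cos φ)) +
      s' * (f * g) / √(phasorNormSq f g (Real.cos φ)) = 0) :
    branchState a d f g s s' φ ∈ reducedSolutions c a d f g := by
  have hunit : ∀ {a d s : ℝ}, s ^ 2 = 1 → 0 < phasorNormSq a d (Real.cos φ) →
      (s * (a + d * Real.cos φ) / √(phasorNormSq a d (Real.cos φ))) ^ 2 +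
      (s * (d * Real.sin φ) / √(phasorNormSq a d (Real.cos φ))) ^ 2 = 1 := by
    intro a d s hs hα
    rw [div_pow, div_pow, Real.sq_sqrt hα.le, ← add_div, div_eq_one_iff_eq hα.ne', phasorNormSq_cos]
    linear_combination ((a + d * Real.cos φ) ^ 2 + (d * Real.sin φ) ^ 2) * hs
  refine vecState_mem_reducedSolutions.2 ⟨?_, by ring, by ring, Real.cos_sq_add_sin_sq _,
    hunit hs hα, hunit hs' hβ⟩
  linear_combination Real.sin φ * h

/-- By `signProduct_eq_zero` either both sign terms are identically zero, or the phasors have equal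
length everywhere and the balance at `x` forces `s + s' = 0`. In both cases the balance holds along
the entire branch through `x`, and moving `φ` gives a curve of solutions. -/
theorem sin_eq_zero_of_isolated (hx : x ∈ isolatedPoints (reducedSolutions c a d f g))
    (hQ : signProduct c a d f g = 0) : x.2 0 = 0 := by
  by_contra hS
  have had := phasor_ne_zero_of_isolated hx
  have hfg := phasor_ne_zero_of_isolated' hx
  obtain ⟨-, e1, e2, hu⟩ := id hx.1
  have hα : 0 < phasorNormSq a d (x.1 0) :=
    (phasorNormSq_nonneg hu a d).lt_of_ne' fun h => hS (phasor_eq_zero hu had h).2.2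
  have hβ : 0 < phasorNormSq f g (x.1 0) :=
    (phasorNormSq_nonneg hu f g).lt_of_ne' fun h => hS (phasor_eq_zero hu hfg h).2.2
  obtain ⟨hs, hw, hw'⟩ := branchSign_spec hu e1 hα
  obtain ⟨hs', hv, hv'⟩ := branchSign_spec hu e2 hβ
  have hbal := (mul_eq_zero.1 (branchBalance_eq_zero hx.1 hα hβ)).resolve_left hS
  obtain ⟨φ, hφ, hφ'⟩ := exists_cos_sin (hu 0)
  set s := branchSign a d 1 x
  set s' := branchSign f g 2 x
  obtain ⟨hc, hcase⟩ := signProduct_eq_zero had hfg hQ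
  have hbal' : ∀ y, c + s * (a * d) / √(phasorNormSq a d y) +
      s' * (f * g) / √(phasorNormSq f g y) = 0 := by
    intro y
    rcases hcase with ⟨hp, hq⟩ | ⟨hpq, hp, heq⟩
    · simp [hc, hp, hq]
    · rw [hc, ← hpq, ← heq, zero_add, ← add_div, ← add_mul] at hbal ⊢
      have h1 := (div_eq_zero_iff.1 hbal).resolve_right (Real.sqrt_pos.2 hα).ne'
      rw [h1, zero_div]
  have hcont : ∀ a d, Continuous fun t => phasorNormSq a d (Real.cos (φ + t)) := by
    intro a d
    unfold phasorNormSq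
    fun_prop
  have hcos0 : Real.cos (φ + 0) = x.1 0 := by rw [add_zero, hφ]
  have hsin0 : Real.sin (φ + 0) = x.2 0 := by rw [add_zero, hφ']
  refine notMem_isolatedPoints_of_curve (fun t => branchState a d f g s s' (φ + t)) ?_ ?_ ?_ ?_ hx
  · have hne : √(phasorNormSq a d (Real.cos (φ + 0))) ≠ 0 := by
      rw [hcos0]
      exact (Real.sqrt_pos.2 hα).ne'
    have hne' : √(phasorNormSq f g (Real.cos (φ + 0))) ≠ 0 := by
      rw [hcos0]
      exact (Real.sqrt_pos.2 hβ).ne'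
    have k1 := (hcont a d).sqrt.continuousAt (x := 0)
    have k2 := (hcont f g).sqrt.continuousAt (x := 0)
    exact ContinuousAt.vecState (by fun_prop)
      (ContinuousAt.prodMk (ContinuousAt.div (by fun_prop) k1 hne)
        (ContinuousAt.div (by fun_prop) k1 hne))
      (ContinuousAt.prodMk (ContinuousAt.div (by fun_prop) k2 hne')
        (ContinuousAt.div (by fun_prop) k2 hne'))
  · simp only [branchState, hcos0, hsin0, ← hw, ← hw', ← hv, ← hv']
    exact vecState_self x
  · filter_upwards [continuousAt_const.eventually_lt (hcont a d).continuousAt (by rwa [hcos0]),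
      continuousAt_const.eventually_lt (hcont f g).continuousAt (by rwa [hcos0])] with t h1 h2
    exact branchState_mem hs hs' h1 h2 (hbal' _)
  · filter_upwards [eventually_rotation_ne φ] with t ht heq
    rw [← vecState_self x] at heq
    have e1 := congrFun (congrArg Prod.fst heq) 0
    have e2 := congrFun (congrArg Prod.snd heq) 0
    simp only [branchState, vecState, Matrix.cons_val_zero] at e1 e2
    exact ht (Prod.ext (e1.trans hφ.symm) (e2.trans hφ'.symm))

end Degenerate

/-! ### The bound for isolated points, and finiteness -/

section Reduced

variable {c a d f g : ℝ}

theorem encard_le_of_finset_card_le {X : Type*} {S : Set X} {n : ℕ}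
    (h : ∀ T : Finset X, (T : Set X) ⊆ S → T.card ≤ n) : S.encard ≤ n := by
  by_contra! hlt
  have hle : ((n + 1 : ℕ) : ℕ∞) ≤ S.encard := by
    have := Order.add_one_le_of_lt hlt
    exact_mod_cast this
  obtain ⟨t, hts, htc⟩ := Set.exists_subset_encard_eq hle
  have htf : t.Finite := Set.finite_of_encard_eq_coe htc
  have h1 := h htf.toFinset (by simpa using hts)
  have h2 := htf.encard_eq_coe_toFinset_card
  rw [htc] at h2
  have h3 : n + 1 = htf.toFinset.card := by exact_mod_cast h2
  omega

theorem encard_le_sixteen_of_regular (had : a ≠ 0 ∨ d ≠ 0) (hfg : f ≠ 0 ∨ g ≠ 0)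
    (hQ : signProduct c a d f g ≠ 0) {S : Set VoltageState} (hS : S ⊆ reducedSolutions c a d f g)
    (hreg : ∀ x ∈ S, ¬ (phasorNormSq a d (x.1 0) = 0 ∧ phasorNormSq f g (x.1 0) = 0)) :
    S.encard ≤ 16 := by
  refine encard_le_of_finset_card_le (n := 16) fun T hT => ?_
  have h1 := sum_solutionWeight_le had hfg hQ (T := T) (fun x hx => hS (hT hx))
    (fun x hx => hreg x (hT hx))
  have h2 : (T.card : ℕ∞) ≤ ∑ x ∈ T, solutionWeight c a d f g x := by
    rw [Finset.card_eq_sum_ones, Nat.cast_sum]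
    refine Finset.sum_le_sum fun x hx => ?_
    simpa using one_le_solutionWeight (hS (hT hx))
  exact_mod_cast h2.trans h1

theorem all_sin_eq_zero (had : a ≠ 0 ∨ d ≠ 0) (hfg : f ≠ 0 ∨ g ≠ 0) {x : VoltageState}
    (hx : x ∈ reducedSolutions c a d f g)
    (hreg : ¬ (phasorNormSq a d (x.1 0) = 0 ∧ phasorNormSq f g (x.1 0) = 0))
    (hS : x.2 0 = 0) : ∀ i, x.2 i = 0 := by
  have hall : x.2 0 = 0 ∧ x.2 1 = 0 ∧ x.2 2 = 0 := by
    by_cases hα : phasorNormSq a d (x.1 0) = 0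
    · exact sin_eq_zero_of_phasor_eq_zero hx had hα fun h => hreg ⟨hα, h⟩
    by_cases hβ : phasorNormSq f g (x.1 0) = 0
    · exact sin_eq_zero_of_phasor_eq_zero' hx hfg hβ hα
    obtain ⟨-, e1, e2, hu⟩ := hx
    obtain ⟨-, -, h1⟩ := branchSign_spec hu e1 ((phasorNormSq_nonneg hu a d).lt_of_ne' hα)
    obtain ⟨-, -, h2⟩ := branchSign_spec hu e2 ((phasorNormSq_nonneg hu f g).lt_of_ne' hβ)
    rw [hS] at h1 h2
    exact ⟨hS, by simpa using h1, by simpa using h2⟩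
  intro i
  fin_cases i
  exacts [hall.1, hall.2.1, hall.2.2]

/-- If `signProduct` vanishes, isolated points have voltages `±1` at all three buses, so there are
at most eight. Otherwise every point has weight at least one, and the weights add up to at most
sixteen. -/
theorem encard_isolatedPoints_reducedSolutions_le :
    (isolatedPoints (reducedSolutions c a d f g)).encard ≤ 16 := by
  rcases (isolatedPoints (reducedSolutions c a d f g)).eq_empty_or_nonempty with hemp | ⟨x₀, hx₀⟩
  · simp [hemp]
  have had := phasor_ne_zero_of_isolated hx₀
  have hfg := phasor_ne_zero_of_isolated' hx₀
  by_cases hQ : signProduct c a d f g = 0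
  · refine encard_le_of_finset_card_le (n := 16) fun T hT => ?_
    have hsin : ∀ x ∈ T, ∀ i, x.2 i = 0 := fun x hx => all_sin_eq_zero had hfg (hT hx).1
      (not_both_phasors_zero_of_isolated (hT hx)) (sin_eq_zero_of_isolated (hT hx) hQ)
    have hcard : T.card ≤ (({1, -1} : Finset ℝ) ×ˢ (({1, -1} : Finset ℝ) ×ˢ
        ({1, -1} : Finset ℝ))).card := by
      refine Finset.card_le_card_of_injOn (fun x => (x.1 0, x.1 1, x.1 2)) ?_ ?_
      · intro x hx
        have hu : ∀ i, x.1 i = 1 ∨ x.1 i = -1 := by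
          intro i
          have h1 := (hT hx).1.2.2.2 i
          rw [hsin x hx i] at h1
          exact sq_eq_one_iff.1 (by linarith)
        simpa using And.intro (hu 0) (And.intro (hu 1) (hu 2))
      · intro x hx y hy hxy
        simp only [Prod.mk.injEq] at hxy
        refine Prod.ext (funext fun i => ?_)
          (funext fun i => (hsin x hx i).trans (hsin y hy i).symm)
        fin_cases i
        exacts [hxy.1, hxy.2.1, hxy.2.2]
    have hne : (1 : ℝ) ≠ -1 := by norm_num
    rw [Finset.card_product, Finset.card_product, Finset.card_pair hne] at hcard
    omega
  · exact encard_le_sixteen_of_regular had hfg hQ (fun x hx => hx.1)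
      fun x hx => not_both_phasors_zero_of_isolated hx

theorem vecState_one_mem : vecState (1, 0) (1, 0) (1, 0) ∈ reducedSolutions c a d f g := by
  rw [vecState_mem_reducedSolutions]
  norm_num

/-- Finiteness of the solution set excludes the degenerate networks. -/
theorem regular_of_finite (hfin : (reducedSolutions c a d f g).Finite) :
    (a ≠ 0 ∨ d ≠ 0) ∧ (f ≠ 0 ∨ g ≠ 0) ∧ signProduct c a d f g ≠ 0 ∧
      ∀ x ∈ reducedSolutions c a d f g,
        ¬ (phasorNormSq a d (x.1 0) = 0 ∧ phasorNormSq f g (x.1 0) = 0) := by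
  have hiso : ∀ x ∈ reducedSolutions c a d f g, x ∈ isolatedPoints (reducedSolutions c a d f g) :=
    fun x hx => hfin.mem_isolatedPoints hx
  have h1 := hiso _ vecState_one_mem
  have had := phasor_ne_zero_of_isolated h1
  have hfg := phasor_ne_zero_of_isolated' h1
  refine ⟨had, hfg, fun hQ => ?_, fun x hx => not_both_phasors_zero_of_isolated (hiso x hx)⟩
  have hpos : ∀ {a d : ℝ}, (a ≠ 0 ∨ d ≠ 0) → 0 < phasorNormSq a d (Real.cos (Real.pi / 2)) := by
    intro a d h
    rw [phasorNormSq_cos, Real.cos_pi_div_two, Real.sin_pi_div_two]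
    rcases h with h | h
    · have := sq_nonneg (d * 1)
      have : 0 < (a + d * 0) ^ 2 := by
        rw [mul_zero, add_zero]
        positivity
      linarith
    · have := sq_nonneg (a + d * 0)
      have : 0 < (d * 1) ^ 2 := by positivity
      linarith
  obtain ⟨hc, hcase⟩ := signProduct_eq_zero had hfg hQ
  -- If `signProduct` vanished, the opposite signs `1, -1` would give a solution at `φ = π / 2`,
  -- where neither phasor vanishes; it would have to be isolated, although `sin φ = 1`.
  have hmem : branchState a d f g 1 (-1) (Real.pi / 2) ∈ reducedSolutions c a d f g := by
    refine branchState_mem (by norm_num) (by norm_num) (hpos had) (hpos hfg) ?_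
    rcases hcase with ⟨hp, hq⟩ | ⟨hpq, -, heq⟩
    · simp [hc, hp, hq]
    · rw [hc, hpq, heq]
      ring
  have h0 := sin_eq_zero_of_isolated (hiso _ hmem) hQ
  simp [branchState, vecState] at h0

theorem finite_reducedSolutions (hc : c ≠ 0) (ha : a ≠ 0) (hd : d ≠ 0) (hf : f ≠ 0) (hg : g ≠ 0)
    (hreg : ∀ x ∈ reducedSolutions c a d f g,
      ¬ (phasorNormSq a d (x.1 0) = 0 ∧ phasorNormSq f g (x.1 0) = 0)) :
    (reducedSolutions c a d f g).Finite := by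
  have hQ : signProduct c a d f g ≠ 0 := by
    intro hQ
    have := signProduct_eq_zero_leading hQ
    simp [hc, ha, hd, hf, hg] at this
  have := encard_le_sixteen_of_regular (Or.inl ha) (Or.inl hf) hQ subset_rfl hreg
  exact Set.finite_of_encard_le_coe this

/-- The phasor `a + d z` with `z` on the unit circle vanishes only if `a ^ 2 = d ^ 2`; so both
phasors never vanish together. -/
theorem finite_reducedSolutions_of_sq_ne (hc : c ≠ 0) (ha : a ≠ 0) (hd : d ≠ 0) (hf : f ≠ 0)
    (hg : g ≠ 0) (hne : a ^ 2 - d ^ 2 ≠ 0) : (reducedSolutions c a d f g).Finite := by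
  refine finite_reducedSolutions hc ha hd hf hg fun x hx h => ?_
  obtain ⟨h1, -, hS⟩ := phasor_eq_zero hx.2.2.2 (Or.inl ha) h.1
  have hu := hx.2.2.2 0
  rw [hS] at hu
  exact hne (by linear_combination (a - d * x.1 0) * h1 + d ^ 2 * hu)

end Reduced

/-! ### Upper bound under perturbation -/

section Perturbation

variable {b : Line → ℝ} (hb : susceptance b 2 3 = 0)
include hb

theorem local_encard_le_solutionWeight {x : VoltageState} {c a d f g : ℝ}
    (hc : susceptance b 0 1 = c) (ha : susceptance b 0 2 = a) (hd : susceptance b 1 2 = d)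
    (hf : susceptance b 0 3 = f) (hg : susceptance b 1 3 = g)
    (had : a ≠ 0 ∨ d ≠ 0) (hfg : f ≠ 0 ∨ g ≠ 0) (hx : x ∈ reducedSolutions c a d f g)
    (hreg : ¬ (phasorNormSq a d (x.1 0) = 0 ∧ phasorNormSq f g (x.1 0) = 0)) :
    ∃ V ∈ 𝓝 x, ∀ᶠ q in 𝓝 (b, (0 : Fin 3 → ℝ)),
      (V ∩ realSolutions q.1 q.2).encard ≤ solutionWeight c a d f g x := by
  subst hc ha hd hf hg
  by_cases hz : phasorNormSq (susceptance b 0 2) (susceptance b 1 2) (x.1 0) = 0 ∨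
      phasorNormSq (susceptance b 0 3) (susceptance b 1 3) (x.1 0) = 0
  · rw [solutionWeight, if_pos hz]
    refine local_encard_le_one hb ?_ (jacobianDet_ne_zero hx had hfg hz hreg)
    rwa [realSolutions_eq_reducedSolutions hb]
  · rw [solutionWeight, if_neg hz]
    push Not at hz
    obtain ⟨-, e1, e2, hu⟩ := id hx
    have hα := (phasorNormSq_nonneg hu _ _).lt_of_ne' hz.1
    have hβ := (phasorNormSq_nonneg hu _ _).lt_of_ne' hz.2
    obtain ⟨hs, hw, hw'⟩ := branchSign_spec hu e1 hα
    obtain ⟨hs', hv, hv'⟩ := branchSign_spec hu e2 hβ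
    set θ : Fin 3 → ℝ := fun i => planeAngle (x.1 i) (x.2 i) with hθ
    have hcs : ∀ i, Real.cos (θ i) = x.1 i ∧ Real.sin (θ i) = x.2 i :=
      fun i => cos_sin_planeAngle (hu i)
    have hxθ : angleState θ = x :=
      Prod.ext (funext fun i => (hcs i).1) (funext fun i => (hcs i).2)
    have := local_encard_le_order hb (θ := θ) hs hs' (by rwa [(hcs 0).1]) (by rwa [(hcs 0).1])
      (by rwa [(hcs 0).1, (hcs 1).1]) (by rwa [(hcs 0).1, (hcs 0).2, (hcs 1).2])
      (by rwa [(hcs 0).1, (hcs 2).1]) (by rwa [(hcs 0).1, (hcs 0).2, (hcs 2).2])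
    rwa [hxθ] at this

theorem eventually_encard_realSolutions_le (hfin : (realSolutions b 0).Finite) :
    ∀ᶠ q in 𝓝 (b, (0 : Fin 3 → ℝ)), (realSolutions q.1 q.2).encard ≤ 16 := by
  have hred := realSolutions_eq_reducedSolutions hb
  have hfin' := hfin
  rw [hred] at hfin'
  obtain ⟨had, hfg, hQ, hreg⟩ := regular_of_finite hfin'
  have hT : ∀ x ∈ hfin.toFinset, x ∈ reducedSolutions (susceptance b 0 1) (susceptance b 0 2)
      (susceptance b 1 2) (susceptance b 0 3) (susceptance b 1 3) := by
    intro x hx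
    rw [← hred]
    exact hfin.mem_toFinset.1 hx
  have := eventually_encard_le_sum isCompact_voltageTorus
    (S := fun q : (Line → ℝ) × (Fin 3 → ℝ) => realSolutions q.1 q.2)
    (fun q => realSolutions_subset_voltageTorus q.1 q.2) isClosed_realSolutions_graph
    (q₀ := (b, 0)) hfin.toFinset (by simp) (solutionWeight _ _ _ _ _)
    (fun x hx => local_encard_le_solutionWeight hb rfl rfl rfl rfl rfl had hfg (hT x hx)
      (hreg x (hT x hx)))
  filter_upwards [this] with q hq
  exact hq.trans (sum_solutionWeight_le had hfg hQ hT fun x hx => hreg x (hT x hx))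

end Perturbation

/-! ### A network with sixteen nondegenerate solutions -/

/-- A network with the maximal number of solutions. -/
noncomputable def extremalSusceptances : Line → ℝ := fun l =>
  -- With `a = d = f = 1` and `g = -1` the phasors `1 ± e^{iφ}` have lengths `2 |cos (φ/2)|` and `2
  -- |sin (φ/2)|`. Absorbing the signs into the half-angle cosine `C` and sine `S`, the balance is
  -- `2 c C S + C + S = 0`. The value `c = 35 / 24` makes the resulting quadratic in `C + S` split
  -- over the rationals.
  if l.1 = s(0, 1) then 35 / 24 else if l.1 = s(1, 3) then -1 else if l.1 = s(2, 3) then 0 else 1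

/-- The cosines and sines of half the phase angle of bus `1` in the solutions that are not real. -/
noncomputable def extremalHalfPhasors : Finset (ℝ × ℝ) :=
  -- With `u = C + S` and `C S = (u² - 1) / 2` the balance is `35 u² + 24 u - 35 = 0`, so `u = -7/5`
  -- or `u = 5/7`; each value gives two pairs.
  {(-4 / 5, -3 / 5), (-3 / 5, -4 / 5), ((5 + √73) / 14, (5 - √73) / 14),
    ((5 - √73) / 14, (5 + √73) / 14)}

theorem sqrt_seventyThree_bounds : 8 < √73 ∧ √73 < 9 :=
  ⟨Real.lt_sqrt_of_sq_lt (by norm_num), (Real.sqrt_lt' (by norm_num)).2 (by norm_num)⟩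

/-- The inequations say that the factors of the Jacobian determinant at the corresponding solutions
are nonzero. -/
theorem extremalHalfPhasors_spec {p : ℝ × ℝ} (hp : p ∈ extremalHalfPhasors) :
    p.1 ^ 2 + p.2 ^ 2 = 1 ∧ 35 / 12 * (p.1 * p.2) + p.1 + p.2 = 0 ∧ p.1 ≠ 0 ∧ p.2 ≠ 0 ∧
      p.1 - p.2 ≠ 0 ∧ 35 / 12 * (p.1 + p.2) + 1 ≠ 0 := by
  obtain ⟨h8, h9⟩ := sqrt_seventyThree_bounds
  have hsq : √73 ^ 2 = (73 : ℝ) := Real.sq_sqrt (by norm_num)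
  simp only [extremalHalfPhasors, Finset.mem_insert, Finset.mem_singleton] at hp
  rcases hp with rfl | rfl | rfl | rfl
  · norm_num
  · norm_num
  · refine ⟨by linear_combination hsq / 98, by linear_combination (-5 / 336) * hsq, ?_, ?_, ?_, ?_⟩ <;>
      intro h <;> simp only at h <;> linarith
  · refine ⟨by linear_combination hsq / 98, by linear_combination (-5 / 336) * hsq, ?_, ?_, ?_, ?_⟩ <;>
      intro h <;> simp only at h <;> linarith

theorem extremalHalfPhasors_injOn {p q : ℝ × ℝ} (hp : p ∈ extremalHalfPhasors)
    (hq : q ∈ extremalHalfPhasors) (h : p.1 = q.1) : p = q := by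
  obtain ⟨h8, h9⟩ := sqrt_seventyThree_bounds
  simp only [extremalHalfPhasors, Finset.mem_insert, Finset.mem_singleton] at hp hq
  rcases hp with rfl | rfl | rfl | rfl <;> rcases hq with rfl | rfl | rfl | rfl <;>
    first | rfl | (exfalso; simp only at h; linarith)

theorem card_extremalHalfPhasors : extremalHalfPhasors.card = 4 := by
  obtain ⟨h8, h9⟩ := sqrt_seventyThree_bounds
  unfold extremalHalfPhasors
  rw [Finset.card_insert_of_notMem, Finset.card_insert_of_notMem, Finset.card_pair]
  · intro h
    have := congrArg Prod.fst h
    simp only at this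
    linarith
  · simp only [Finset.mem_insert, Finset.mem_singleton, Prod.mk.injEq, not_or, not_and_or]
    exact ⟨Or.inl fun h => by linarith, Or.inl fun h => by linarith⟩
  · simp only [Finset.mem_insert, Finset.mem_singleton, Prod.mk.injEq, not_or, not_and_or]
    exact ⟨Or.inl fun h => by linarith, Or.inl fun h => by linarith, Or.inl fun h => by linarith⟩

/-- The solution belonging to a half phasor and a sign of the phase angles. -/
def halfPhasorState (p : (ℝ × ℝ) × ℝ) : VoltageState :=
  -- For sign `1` and half phasor `h = C + iS` the voltages are `h²`, `h`, `ih`: indeed `1 + h² = 2C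
  -- h` and `1 - h² = -2S (ih)`. The sign `-1` conjugates them.
  vecState (p.1.1 ^ 2 - p.1.2 ^ 2, p.2 * (2 * p.1.1 * p.1.2)) (p.1.1, p.2 * p.1.2)
    (-p.1.2, p.2 * p.1.1)

/-- The state with the given real voltages. -/
def realState (p : ℝ × ℝ × ℝ) : VoltageState := vecState (p.1, 0) (p.2.1, 0) (p.2.2, 0)

/-- The sixteen solutions of the extremal network. -/
noncomputable def extremalSolutions : Finset VoltageState := by
  classical
  exact (({1, -1} : Finset ℝ) ×ˢ (({1, -1} : Finset ℝ) ×ˢ ({1, -1} : Finset ℝ))).image realState ∪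
    (extremalHalfPhasors ×ˢ ({1, -1} : Finset ℝ)).image halfPhasorState

theorem mem_pm_one {s : ℝ} : s ∈ ({1, -1} : Finset ℝ) ↔ s ^ 2 = 1 := by
  rw [sq_eq_one_iff]
  simp

theorem card_extremalSolutions : extremalSolutions.card = 16 := by
  classical
  have hne : (1 : ℝ) ≠ -1 := by norm_num
  unfold extremalSolutions
  rw [Finset.card_union_of_disjoint, Finset.card_image_of_injOn, Finset.card_image_of_injOn,
    Finset.card_product, Finset.card_product, Finset.card_product, Finset.card_pair hne,
    card_extremalHalfPhasors]
  · rintro ⟨p, s⟩ hp ⟨q, s'⟩ hq h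
    have hp' := (Finset.mem_product.1 hp).1
    have hq' := (Finset.mem_product.1 hq).1
    have h1 : p.1 = q.1 := congrFun (congrArg Prod.fst h) 1
    obtain rfl := extremalHalfPhasors_injOn hp' hq' h1
    have h2 : s * p.2 = s' * p.2 := congrFun (congrArg Prod.snd h) 1
    rw [mul_right_cancel₀ (extremalHalfPhasors_spec hp').2.2.2.1 h2]
  · rintro ⟨p, q, r⟩ - ⟨p', q', r'⟩ - h
    have h0 : p = p' := congrFun (congrArg Prod.fst h) 0
    have h1 : q = q' := congrFun (congrArg Prod.fst h) 1
    have h2 : r = r' := congrFun (congrArg Prod.fst h) 2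
    rw [h0, h1, h2]
  · refine Finset.disjoint_left.2 fun x hx hx' => ?_
    obtain ⟨p, -, rfl⟩ := Finset.mem_image.1 hx
    obtain ⟨⟨q, s⟩, hq, h⟩ := Finset.mem_image.1 hx'
    obtain ⟨hq1, hs⟩ := Finset.mem_product.1 hq
    have h2 : s * q.2 = 0 := congrFun (congrArg Prod.snd h) 1
    have hs0 : s ≠ 0 := by
      rintro rfl
      have := mem_pm_one.1 hs
      norm_num at this
    exact (mul_ne_zero hs0 (extremalHalfPhasors_spec hq1).2.2.2.1) h2

theorem extremalSolutions_spec {x : VoltageState} (hx : x ∈ extremalSolutions) :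
    x ∈ reducedSolutions (35 / 24) 1 1 1 (-1) ∧ jacobianDet (35 / 24) 1 1 1 (-1) x ≠ 0 := by
  classical
  unfold extremalSolutions at hx
  rcases Finset.mem_union.1 hx with hx | hx
  · obtain ⟨⟨p, q, r⟩, hp, rfl⟩ := Finset.mem_image.1 hx
    obtain ⟨hp, hqr⟩ := Finset.mem_product.1 hp
    obtain ⟨hq, hr⟩ := Finset.mem_product.1 hqr
    simp only at hp hq hr
    have hp1 := mem_pm_one.1 hp
    have hq1 := mem_pm_one.1 hq
    have hr1 := mem_pm_one.1 hr
    constructor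
    · rw [realState, vecState_mem_reducedSolutions]
      simp [hp1, hq1, hr1]
    · rw [← mem_pm_one] at hp1 hq1 hr1
      simp only [Finset.mem_insert, Finset.mem_singleton] at hp1 hq1 hr1
      simp only [jacobianDet, realState, vecState, Matrix.cons_val_zero, Matrix.cons_val_one,
        Matrix.cons_val]
      rcases hp1 with rfl | rfl <;> rcases hq1 with rfl | rfl <;> rcases hr1 with rfl | rfl <;>
        norm_num
  · obtain ⟨⟨⟨C, S⟩, s⟩, hp, rfl⟩ := Finset.mem_image.1 hx
    obtain ⟨hp, hs⟩ := Finset.mem_product.1 hp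
    obtain ⟨h1, h2, h3, h4, h5, h6⟩ := extremalHalfPhasors_spec hp
    simp only at h1 h2 h3 h4 h5 h6 hs
    have hs1 := mem_pm_one.1 hs
    constructor
    · rw [halfPhasorState, vecState_mem_reducedSolutions]
      refine ⟨?_, ?_, ?_, ?_, ?_, ?_⟩ <;> simp only
      · linear_combination s * h2 + s * (C + S) * h1
      · linear_combination (-s * S) * h1
      · linear_combination (-s * C) * h1
      · linear_combination 4 * C ^ 2 * S ^ 2 * hs1 + (C ^ 2 + S ^ 2 + 1) * h1
      · linear_combination S ^ 2 * hs1 + h1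
      · linear_combination C ^ 2 * hs1 + h1
    · have hD : (C ^ 2 - S ^ 2) * C + s * (2 * C * S) * (s * S) = C := by
        linear_combination 2 * C * S ^ 2 * hs1 + C * h1
      have hG : (C ^ 2 - S ^ 2) * -S + s * (2 * C * S) * (s * C) = S := by
        linear_combination 2 * C ^ 2 * S * hs1 + S * h1
      have hdet : jacobianDet (35 / 24) 1 1 1 (-1) (halfPhasorState ((C, S), s)) =
          -2 * C * S * (C - S) * (35 / 12 * (C + S) + 1) := by
        simp only [jacobianDet, halfPhasorState, vecState, Matrix.cons_val_zero,
          Matrix.cons_val_one, Matrix.cons_val, hD, hG]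
        ring
      rw [hdet]
      simp [h3, h4, h5, h6]

theorem extremalSusceptances_spec : susceptance extremalSusceptances 0 1 = 35 / 24 ∧
    susceptance extremalSusceptances 0 2 = 1 ∧ susceptance extremalSusceptances 1 2 = 1 ∧
    susceptance extremalSusceptances 0 3 = 1 ∧ susceptance extremalSusceptances 1 3 = -1 ∧
    susceptance extremalSusceptances 2 3 = 0 := by
  simp [susceptance, extremalSusceptances]

theorem eventually_encard_extremal :
    ∀ᶠ q in 𝓝 (extremalSusceptances, (0 : Fin 3 → ℝ)), (realSolutions q.1 q.2).encard = 16 := by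
  obtain ⟨hc, ha, hd, hf, hg, hb⟩ := extremalSusceptances_spec
  have hred := realSolutions_eq_reducedSolutions hb
  rw [hc, ha, hd, hf, hg] at hred
  have hfin : (realSolutions extremalSusceptances 0).Finite := by
    rw [hred]
    refine finite_reducedSolutions (by norm_num) one_ne_zero one_ne_zero one_ne_zero (by norm_num)
      fun x _ h => ?_
    unfold phasorNormSq at h
    -- The squared lengths `2 + 2y` and `2 - 2y` cannot both vanish.
    linarith [h.1, h.2]
  have hlow := eventually_card_le_encard extremalSolutions
    (S := fun q : (Line → ℝ) × (Fin 3 → ℝ) => realSolutions q.1 q.2)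
    (q₀ := (extremalSusceptances, 0)) fun x hx U hU => by
      obtain ⟨h1, h2⟩ := extremalSolutions_spec hx
      refine eventually_nonempty_inter hb (by rwa [hred]) ?_ hU
      rwa [hc, ha, hd, hf, hg]
  rw [card_extremalSolutions] at hlow
  filter_upwards [hlow, eventually_encard_realSolutions_le hb hfin] with q h1 h2
  exact le_antisymm h2 h1

/-! ### Relabelling the buses, the slack bus included -/

section Relabel

/-- Relabelling of the lines by a permutation of the buses. -/
def relabelLine (π : Equiv.Perm (Fin 4)) (l : Line) : Line :=
  ⟨Sym2.map π l.1, by rw [Sym2.isDiag_map π.injective]; exact l.2⟩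

/-- The power injections at all buses; those of a solvable lossless network add up to zero. -/
def busInjection (P : Fin 3 → ℝ) : Fin 4 → ℝ := Fin.cons (-∑ i, P i) P

/-- Relabelling of the parameters of a network. -/
def relabelData (π : Equiv.Perm (Fin 4)) (q : (Line → ℝ) × (Fin 3 → ℝ)) :
    (Line → ℝ) × (Fin 3 → ℝ) :=
  (fun l => q.1 (relabelLine π l), fun i => busInjection q.2 (π i.succ))

/-- Relabelling of a state, followed by the rotation that restores the slack voltage. -/
def relabelState (π : Equiv.Perm (Fin 4)) (x : VoltageState) : VoltageState :=
  (fun i => busVd x (π i.succ) * busVd x (π 0) + busVq x (π i.succ) * busVq x (π 0),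
    fun i => busVq x (π i.succ) * busVd x (π 0) - busVd x (π i.succ) * busVq x (π 0))

theorem continuous_relabelState (π : Equiv.Perm (Fin 4)) : Continuous (relabelState π) := by
  have hd := continuous_busVd
  have hq := continuous_busVq
  refine Continuous.prodMk (continuous_pi fun i => ?_) (continuous_pi fun i => ?_)
  · exact ((hd _).mul (hd _)).add ((hq _).mul (hq _))
  · exact ((hq _).mul (hd _)).sub ((hd _).mul (hq _))

theorem continuous_busInjection (k : Fin 4) : Continuous fun P : Fin 3 → ℝ => busInjection P k := by
  refine Fin.cases ?_ (fun j => ?_) k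
  · simp only [busInjection, Fin.cons_zero]
    fun_prop
  · simp only [busInjection, Fin.cons_succ]
    fun_prop

theorem continuous_relabelData (π : Equiv.Perm (Fin 4)) : Continuous (relabelData π) :=
  Continuous.prodMk (by fun_prop)
    (continuous_pi fun i => (continuous_busInjection (π i.succ)).comp continuous_snd)

theorem susceptance_relabel (π : Equiv.Perm (Fin 4)) (b : Line → ℝ) (i k : Fin 4) :
    susceptance (fun l => b (relabelLine π l)) i k = susceptance b (π i) (π k) := by
  unfold susceptance
  by_cases h : i = k
  · simp [h]
  · have h' : ¬ π i = π k := fun h' => h (π.injective h')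
    simp [h, relabelLine]

theorem busInjection_zero (k : Fin 4) : busInjection 0 k = 0 := by
  refine Fin.cases ?_ (fun j => ?_) k <;> simp [busInjection]

theorem sum_busInjection (P : Fin 3 → ℝ) : ∑ k, busInjection P k = 0 := by
  simp [Fin.sum_univ_succ, busInjection]

/-- The slack injection is fixed by the total being zero, which permutations preserve. -/
theorem busInjection_relabel (π : Equiv.Perm (Fin 4)) (P : Fin 3 → ℝ) (k : Fin 4) :
    busInjection (fun i => busInjection P (π i.succ)) k = busInjection P (π k) := by
  refine Fin.cases ?_ (fun j => ?_) k
  · have h1 : ∑ k, busInjection P (π k) = 0 := by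
      rw [Equiv.sum_comp π (busInjection P), sum_busInjection]
    rw [Fin.sum_univ_succ] at h1
    simp only [busInjection, Fin.cons_zero] at h1 ⊢
    linarith
  · simp [busInjection]

theorem relabelData_zero (π : Equiv.Perm (Fin 4)) (b : Line → ℝ) :
    relabelData π (b, 0) = (fun l => b (relabelLine π l), 0) := by
  refine Prod.ext rfl (funext fun i => ?_)
  simp [relabelData, busInjection_zero]

theorem relabelLine_inv (π : Equiv.Perm (Fin 4)) (l : Line) :
    relabelLine π (relabelLine π⁻¹ l) = l := by
  apply Subtype.ext
  simp only [relabelLine, Sym2.map_map]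
  have : (⇑π ∘ ⇑π⁻¹) = id := by
    ext i
    simp
  rw [this, Sym2.map_id, id]

theorem relabelLine_inv' (π : Equiv.Perm (Fin 4)) (l : Line) :
    relabelLine π⁻¹ (relabelLine π l) = l := by
  simpa using relabelLine_inv π⁻¹ l

theorem relabelData_inv (π : Equiv.Perm (Fin 4)) (q : (Line → ℝ) × (Fin 3 → ℝ)) :
    relabelData π⁻¹ (relabelData π q) = q := by
  refine Prod.ext (funext fun l => ?_) (funext fun i => ?_)
  · simp only [relabelData, relabelLine_inv]
  · have hinv : π (π⁻¹ i.succ) = i.succ := by simp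
    simp only [relabelData, busInjection_relabel, hinv]
    simp [busInjection]

theorem bus_unit {x : VoltageState} (hx : x ∈ voltageTorus) (k : Fin 4) :
    busVd x k ^ 2 + busVq x k ^ 2 = 1 := by
  refine Fin.cases ?_ (fun j => ?_) k
  · simp [busVd, busVq]
  · simpa [busVd, busVq] using hx j

theorem busVd_relabelState (π : Equiv.Perm (Fin 4)) {x : VoltageState} (hx : x ∈ voltageTorus)
    (k : Fin 4) : busVd (relabelState π x) k =
      busVd x (π k) * busVd x (π 0) + busVq x (π k) * busVq x (π 0) := by
  refine Fin.cases ?_ (fun j => ?_) k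
  · rw [← sq, ← sq, bus_unit hx]
    simp [busVd]
  · simp only [busVd, Fin.cons_succ, relabelState]

theorem busVq_relabelState (π : Equiv.Perm (Fin 4)) (x : VoltageState) (k : Fin 4) :
    busVq (relabelState π x) k =
      busVq x (π k) * busVd x (π 0) - busVd x (π k) * busVq x (π 0) := by
  refine Fin.cases ?_ (fun j => ?_) k
  · simp only [busVq, Fin.cons_zero]
    ring
  · simp only [busVq, Fin.cons_succ, relabelState]

theorem relabelState_mem_voltageTorus (π : Equiv.Perm (Fin 4)) {x : VoltageState}
    (hx : x ∈ voltageTorus) : relabelState π x ∈ voltageTorus := by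
  intro i
  have h1 := bus_unit hx (π i.succ)
  have h2 := bus_unit hx (π 0)
  simp only [relabelState]
  linear_combination (busVd x (π 0) ^ 2 + busVq x (π 0) ^ 2) * h1 + h2

theorem relabelState_inv (π : Equiv.Perm (Fin 4)) {x : VoltageState} (hx : x ∈ voltageTorus) :
    relabelState π⁻¹ (relabelState π x) = x := by
  have h0 := bus_unit hx (π 0)
  have hd0 : busVd x 0 = 1 := rfl
  have hq0 : busVq x 0 = 0 := rfl
  have hinv : ∀ k, π (π⁻¹ k) = k := fun k => by simp
  have hu := relabelState_mem_voltageTorus π hx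
  refine Prod.ext (funext fun i => ?_) (funext fun i => ?_)
  · change busVd (relabelState π⁻¹ (relabelState π x)) i.succ = busVd x i.succ
    simp only [busVd_relabelState π⁻¹ hu, busVd_relabelState π hx, busVq_relabelState, hinv,
      hd0, hq0]
    linear_combination busVd x i.succ * h0
  · change busVq (relabelState π⁻¹ (relabelState π x)) i.succ = busVq x i.succ
    simp only [busVd_relabelState π hx, busVq_relabelState, hinv, hd0, hq0]
    linear_combination busVq x i.succ * h0

/-- At a solution, the power balance holds at the slack bus as well. -/
theorem balance_all_buses {b : Line → ℝ} {P : Fin 3 → ℝ} {x : VoltageState}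
    (hx : x ∈ realSolutions b P) (i : Fin 4) :
    ∑ k, susceptance b i k * (busVd x k * busVq x i - busVd x i * busVq x k) =
      busInjection P i := by
  have hsucc : ∀ j : Fin 3, ∑ k, susceptance b j.succ k *
      (busVd x k * busVq x j.succ - busVd x j.succ * busVq x k) = busInjection P j.succ := by
    intro j
    rw [(hx j).1]
    simp [busInjection]
  refine Fin.cases ?_ hsucc i
  set t : Fin 4 → Fin 4 → ℝ := fun i k =>
    susceptance b i k * (busVd x k * busVq x i - busVd x i * busVq x k) with ht
  -- The flow from one bus to another is antisymmetric, as the lines are lossless.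
  have hanti : ∑ i, ∑ k, t i k = 0 := by
    have h1 : ∑ i, ∑ k, t i k = ∑ i, ∑ k, -t i k := by
      rw [Finset.sum_comm]
      refine Finset.sum_congr rfl fun i _ => Finset.sum_congr rfl fun k _ => ?_
      simp only [ht, susceptance_comm b k i]
      ring
    simp only [Finset.sum_neg_distrib] at h1
    linarith
  rw [Fin.sum_univ_succ, Finset.sum_congr rfl fun j _ => hsucc j] at hanti
  have h2 := sum_busInjection P
  rw [Fin.sum_univ_succ] at h2
  linarith

/-- Rotating all voltages by one unit phasor does not change the flows. Since `π` may move the slack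
bus, the balance there is needed too, from `balance_all_buses`. -/
theorem relabelState_mem (π : Equiv.Perm (Fin 4)) {q : (Line → ℝ) × (Fin 3 → ℝ)}
    {x : VoltageState} (hx : x ∈ realSolutions q.1 q.2) :
    relabelState π x ∈ realSolutions (relabelData π q).1 (relabelData π q).2 := by
  have hu := realSolutions_subset_voltageTorus _ _ hx
  intro i
  refine ⟨?_, bus_unit (relabelState_mem_voltageTorus π hu) i.succ⟩
  have h0 := bus_unit hu (π 0)
  simp only [relabelData, susceptance_relabel, busVd_relabelState π hu, busVq_relabelState]
  rw [← balance_all_buses hx (π i.succ)]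
  refine Eq.trans (Finset.sum_congr rfl fun k _ => ?_) (Equiv.sum_comp π fun k =>
    susceptance q.1 (π i.succ) k * (busVd x k * busVq x (π i.succ) - busVd x (π i.succ) * busVq x k))
  linear_combination (susceptance q.1 (π i.succ) (π k) *
    (busVd x (π k) * busVq x (π i.succ) - busVd x (π i.succ) * busVq x (π k))) * h0

theorem relabelState_injOn (π : Equiv.Perm (Fin 4)) (q : (Line → ℝ) × (Fin 3 → ℝ)) :
    Set.InjOn (relabelState π) (realSolutions q.1 q.2) := by
  intro x hx y hy h
  rw [← relabelState_inv π (realSolutions_subset_voltageTorus _ _ hx), h,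
    relabelState_inv π (realSolutions_subset_voltageTorus _ _ hy)]

theorem encard_realSolutions_relabel (π : Equiv.Perm (Fin 4)) (q : (Line → ℝ) × (Fin 3 → ℝ)) :
    (realSolutions (relabelData π q).1 (relabelData π q).2).encard =
      (realSolutions q.1 q.2).encard := by
  refine le_antisymm ?_ (encard_le_encard_of_injOn
    (fun x hx => relabelState_mem π hx) (relabelState_injOn π q))
  have := encard_le_encard_of_injOn (fun x hx => relabelState_mem π⁻¹ hx)
    (relabelState_injOn π⁻¹ (relabelData π q))
  rwa [relabelData_inv] at this

theorem relabelState_mem_isolatedPoints (π : Equiv.Perm (Fin 4))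
    {q : (Line → ℝ) × (Fin 3 → ℝ)} {x : VoltageState}
    (hx : x ∈ isolatedPoints (realSolutions q.1 q.2)) : relabelState π x ∈
      isolatedPoints (realSolutions (relabelData π q).1 (relabelData π q).2) := by
  obtain ⟨hxS, U, hU, hUS⟩ := hx
  have hxU : x ∈ U := (hUS.symm ▸ mem_singleton x : x ∈ U ∩ realSolutions q.1 q.2).1
  have hxT := relabelState_inv π (realSolutions_subset_voltageTorus _ _ hxS)
  refine ⟨relabelState_mem π hxS, relabelState π⁻¹ ⁻¹' U,
    hU.preimage (continuous_relabelState π⁻¹), ?_⟩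
  ext y
  simp only [mem_inter_iff, mem_preimage, mem_singleton_iff]
  constructor
  · rintro ⟨hyU, hy⟩
    have h1 := relabelState_mem π⁻¹ hy
    rw [relabelData_inv] at h1
    have h2 : relabelState π⁻¹ y = x :=
      (hUS ▸ (⟨hyU, h1⟩ : relabelState π⁻¹ y ∈ U ∩ realSolutions q.1 q.2) : _ ∈ ({x} : Set _))
    rw [← h2]
    have h3 := relabelState_inv π⁻¹ (realSolutions_subset_voltageTorus _ _ hy)
    rw [inv_inv] at h3
    exact h3.symm
  · rintro rfl
    exact ⟨by rwa [hxT], relabelState_mem π hxS⟩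

theorem encard_isolatedPoints_relabel_le (π : Equiv.Perm (Fin 4))
    (q : (Line → ℝ) × (Fin 3 → ℝ)) : (isolatedPoints (realSolutions q.1 q.2)).encard ≤
      (isolatedPoints (realSolutions (relabelData π q).1 (relabelData π q).2)).encard :=
  encard_le_encard_of_injOn (fun _ hx => relabelState_mem_isolatedPoints π hx)
    ((relabelState_injOn π q).mono fun _ hx => hx.1)

theorem exists_relabelLine_eq (l : Line) : ∃ π : Equiv.Perm (Fin 4),
    ∀ h, relabelLine π ⟨s(2, 3), h⟩ = l := by
  obtain ⟨l, hl⟩ := l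
  induction l using Sym2.ind with
  | _ i k =>
    have hik : i ≠ k := by simpa using hl
    have : ∀ i k : Fin 4, i ≠ k → ∃ π : Equiv.Perm (Fin 4), π 2 = i ∧ π 3 = k := by decide
    obtain ⟨π, h2, h3⟩ := this i k hik
    exact ⟨π, fun h => Subtype.ext (by simp [relabelLine, h2, h3])⟩

end Relabel

/-! ### Genericity and conclusion for an arbitrary line -/

/-- The line between two distinct buses. -/
def busLine (i k : Fin 4) (h : i ≠ k := by decide) : Line := ⟨s(i, k), by simpa using h⟩

theorem susceptance_eq_busLine (b : Line → ℝ) {i k : Fin 4} (h : i ≠ k) :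
    susceptance b i k = b (busLine i k h) := by
  simp [susceptance, busLine, h]

open MvPolynomial in
/-- A polynomial that vanishes where the network without the line `{2, 3}` degenerates. -/
noncomputable def degeneracyPoly : MvPolynomial Line ℝ :=
  X (busLine 0 1) * X (busLine 0 2) * X (busLine 1 2) * X (busLine 0 3) * X (busLine 1 3) *
    (X (busLine 0 2) ^ 2 - X (busLine 1 2) ^ 2)

theorem eval_degeneracyPoly (b : Line → ℝ) : MvPolynomial.eval b degeneracyPoly =
    susceptance b 0 1 * susceptance b 0 2 * susceptance b 1 2 * susceptance b 0 3 *
      susceptance b 1 3 * (susceptance b 0 2 ^ 2 - susceptance b 1 2 ^ 2) := by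
  rw [susceptance_eq_busLine b (show (0 : Fin 4) ≠ 1 by decide),
    susceptance_eq_busLine b (show (0 : Fin 4) ≠ 2 by decide),
    susceptance_eq_busLine b (show (1 : Fin 4) ≠ 2 by decide),
    susceptance_eq_busLine b (show (0 : Fin 4) ≠ 3 by decide),
    susceptance_eq_busLine b (show (1 : Fin 4) ≠ 3 by decide)]
  simp [degeneracyPoly]

/-- A nondegenerate network without the line `{2, 3}`. -/
noncomputable def regularSusceptances : Line → ℝ := fun l =>
  if l.1 = s(0, 2) then 2 else if l.1 = s(2, 3) then 0 else 1

theorem regularSusceptances_spec : susceptance regularSusceptances 0 1 = 1 ∧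
    susceptance regularSusceptances 0 2 = 2 ∧ susceptance regularSusceptances 1 2 = 1 ∧
    susceptance regularSusceptances 0 3 = 1 ∧ susceptance regularSusceptances 1 3 = 1 ∧
    susceptance regularSusceptances 2 3 = 0 := by
  simp [susceptance, regularSusceptances]

theorem finite_realSolutions_of_degeneracyPoly {b : Line → ℝ} (hb : susceptance b 2 3 = 0)
    (h : MvPolynomial.eval b degeneracyPoly ≠ 0) : (realSolutions b 0).Finite := by
  rw [eval_degeneracyPoly] at h
  simp only [mul_ne_zero_iff] at h
  obtain ⟨⟨⟨⟨⟨h1, h2⟩, h3⟩, h4⟩, h5⟩, h6⟩ := h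
  rw [realSolutions_eq_reducedSolutions hb]
  exact finite_reducedSolutions_of_sq_ne h1 h2 h3 h4 h5 h6

theorem mainTheorem2 (e : Line) :
    (∀ b : Line → ℝ, b e = 0 → (isolatedPoints (realSolutions b 0)).encard ≤ 16) ∧
    (∀ b : Line → ℝ, b e = 0 → (realSolutions b 0).Finite →
      ∀ᶠ q : (Line → ℝ) × (Fin 3 → ℝ) in 𝓝 (b, 0), (realSolutions q.1 q.2).encard ≤ 16) ∧
    (∃ p : MvPolynomial Line ℝ, (∃ b : Line → ℝ, b e = 0 ∧ MvPolynomial.eval b p ≠ 0) ∧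
      ∀ b : Line → ℝ, b e = 0 → MvPolynomial.eval b p ≠ 0 → (realSolutions b 0).Finite) ∧
    (∃ b : Line → ℝ, b e = 0 ∧
      ∀ᶠ q : (Line → ℝ) × (Fin 3 → ℝ) in 𝓝 (b, 0), (realSolutions q.1 q.2).encard = 16) := by
  obtain ⟨π, hπ⟩ := exists_relabelLine_eq e
  have h23 : (2 : Fin 4) ≠ 3 := by decide
  have he : relabelLine π (busLine 2 3) = e := hπ _
  have he' : relabelLine π⁻¹ e = busLine 2 3 := by rw [← he, relabelLine_inv']
  have hzero : ∀ b : Line → ℝ, b e = 0 → susceptance (fun l => b (relabelLine π l)) 2 3 = 0 := by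
    intro b hb
    rw [susceptance_eq_busLine _ h23, he, hb]
  have hback : ∀ b : Line → ℝ, susceptance b 2 3 = 0 → b (relabelLine π⁻¹ e) = 0 := by
    intro b hb
    rwa [he', ← susceptance_eq_busLine b h23]
  have hcard : ∀ b : Line → ℝ, (realSolutions (fun l => b (relabelLine π l)) 0).encard =
      (realSolutions b 0).encard := by
    intro b
    have := encard_realSolutions_relabel π (b, 0)
    rwa [relabelData_zero] at this
  -- Relabelling is continuous in the data and preserves the number of solutions, so statements
  -- about nearby systems can be pulled back.
  have hpull : ∀ (b : Line → ℝ) (n : ℕ∞ → Prop),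
      (∀ᶠ q in 𝓝 ((fun l => b (relabelLine π l)), (0 : Fin 3 → ℝ)),
        n (realSolutions q.1 q.2).encard) →
      ∀ᶠ q in 𝓝 (b, (0 : Fin 3 → ℝ)), n (realSolutions q.1 q.2).encard := by
    intro b n h
    rw [← relabelData_zero] at h
    filter_upwards [(continuous_relabelData π).continuousAt.eventually h] with q hq
    rwa [encard_realSolutions_relabel] at hq
  refine ⟨fun b hb => ?_, fun b hb hfin => ?_, ?_, ?_⟩
  · refine (encard_isolatedPoints_relabel_le π (b, 0)).trans ?_
    rw [relabelData_zero, realSolutions_eq_reducedSolutions (hzero b hb)]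
    exact encard_isolatedPoints_reducedSolutions_le
  · refine hpull b (· ≤ 16) (eventually_encard_realSolutions_le (hzero b hb) ?_)
    rwa [← encard_lt_top_iff, hcard, encard_lt_top_iff]
  · obtain ⟨h01, h02, h12, h03, h13, h23'⟩ := regularSusceptances_spec
    refine ⟨MvPolynomial.rename (relabelLine π) degeneracyPoly,
      ⟨fun l => regularSusceptances (relabelLine π⁻¹ l), hback _ h23', ?_⟩, fun b hb h => ?_⟩
    · rw [MvPolynomial.eval_rename, Function.comp_def]
      simp only [relabelLine_inv']
      rw [eval_degeneracyPoly, h01, h02, h12, h03, h13]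
      norm_num
    · rw [MvPolynomial.eval_rename] at h
      have := finite_realSolutions_of_degeneracyPoly (hzero b hb) h
      rwa [← encard_lt_top_iff, hcard, encard_lt_top_iff] at this
  · refine ⟨fun l => extremalSusceptances (relabelLine π⁻¹ l),
      hback _ extremalSusceptances_spec.2.2.2.2.2, hpull _ (· = 16) ?_⟩
    simp only [relabelLine_inv']
    exact eventually_encard_extremal
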